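/- A \emph{$D$-set} is a set $\Omega$ with a quaternary relation $D(wx;yz)$ such that for all $w,x,y,z\in\Omega$: (D1) $D(wx;yz)\Rightarrow D(xw;yz)\wedge D(yz;wx)$; (D2) $D(wx;yz)\Rightarrow\neg D(wy;xz)$; (D3) $D(wx;yz)\Rightarrow\forall v\,\bigl(D(vx;yz)\vee D(wx;yv)\bigr)$; (D4) if $w\neq y$ and $x\neq y$ then $D(wx;yy)$. It is \emph{proper} if it has at least three elements and for all pairwise distinct $w,x,y$ there is $z\neq y$ with $D(wx;yz)$. It is \emph{dense} if it has at least two elements and whenever $D(wx;yz)$ holds there is $v$ with $D(vx;yz)$, $D(wv;yz)$, $D(wx;vz)$ and $D(wx;yv)$. Every subset of a $D$-set is a $D$-set with the restricted relation. A \emph{splitting} of a $D$-set is a partition of it into at least two (nonempty) sets, called \emph{sectors}, such that (i) $D(ab;cd)$ holds whenever $a,b$ lie in one sector $\Sigma$ and $c,d$ lie outside $\Sigma$, and (ii) $D(ab;cd)$ fails whenever $a,b,c,d$ lie in four different sectors. It is a \emph{node splitting} if it has more than two sectors and an \emph{edge splitting} if it has exactly two. A \emph{true edge splitting} is an edge splitting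 that cannot be refined to a node splitting and has no singleton sector. For $P\subseteq\Omega$, the structure $(\Omega;D,P)$ is \emph{$P$-homogeneous} if $P\neq\emptyset$, $P\neq\Omega$, and every isomorphism $\phi:A\to B$ (with respect to $D$ and $P$) between finite substructures $A,B\subseteq\Omega$ such that $A\cap P$, $A\setminus P$, $B\cap P$, $B\setminus P$ are all nonempty extends to an automorphism of $(\Omega;D,P)$. \textbf{Theorem.} Let $\Omega$ be a proper countable $D$-set with a unary predicate $P\subseteq\Omega$. Then $\Omega$ is $P$-homogeneous if and only if all of the following hold: \begin{enumerate} \item $\Omega$ is dense; \item any two node splittings of the $D$-set $P$ (with the restricted relation) have the same number of sectors, and any two node splittings of the $D$-set $\Omega\setminus P$ have the same number of sectors; \item at least one of the following holds: (a) $\Sigma\cap P\neq\emptyset$ and $\Sigma\setminus P\neq\emptyset$ for every infinite sector $\Sigma$ of every splitting of $\Omega$; (b) $\{P,\Omega\setminus P\}$ is a true edge splitting of $\Omega$; (c) $|P|=1$ or $|\Omega\setminus P|=1$. \end{enumerate} -/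

import Mathlib

universe u

/-- A `D`-set structure on `Ω`: a quaternary relation `D w x y z`, written `D(wx; yz)`,
satisfying (D1)-(D4). -/
structure DSet (Ω : Type u) where
  D : Ω → Ω → Ω → Ω → Prop
  d1 : ∀ w x y z, D w x y z → D x w y z ∧ D y z w x
  d2 : ∀ w x y z, D w x y z → ¬ D w y x z
  d3 : ∀ w x y z, D w x y z → ∀ v, D v x y z ∨ D w x y v
  d4 : ∀ w x y, w ≠ y → x ≠ y → D w x y y

namespace DSet

variable {Ω : Type u}

/-- A proper `D`-set: at least three elements, and axiom (D5). -/
def IsProper (𝒟 : DSet Ω) : Prop :=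
  3 ≤ ENat.card Ω ∧
    ∀ w x y : Ω, w ≠ x → w ≠ y → x ≠ y → ∃ z, z ≠ y ∧ 𝒟.D w x y z

/-- A dense `D`-set: at least two elements, and axiom (D6). -/
def IsDense (𝒟 : DSet Ω) : Prop :=
  2 ≤ ENat.card Ω ∧
    ∀ w x y z : Ω, 𝒟.D w x y z →
      ∃ v, 𝒟.D v x y z ∧ 𝒟.D w v y z ∧ 𝒟.D w x v z ∧ 𝒟.D w x y v

/-- The `D`-set induced on a subset `S` of `Ω` (a substructure, since the language is
relational). -/
def restrict (𝒟 : DSet Ω) (S : Set Ω) : DSet S where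
  D w x y z := 𝒟.D w x y z
  d1 _ _ _ _ h := 𝒟.d1 _ _ _ _ h
  d2 _ _ _ _ h := 𝒟.d2 _ _ _ _ h
  d3 _ _ _ _ h v := 𝒟.d3 _ _ _ _ h v
  d4 _ _ _ hw hx :=
    𝒟.d4 _ _ _ (fun h => hw (Subtype.ext h)) (fun h => hx (Subtype.ext h))

/-- A splitting of `Ω`: a partition `C` of `Ω` into (nonempty) sets, called sectors, with at
least two sectors, such that `D(ab; cd)` holds whenever `a, b` lie in a sector and `c, d` lie
outside it, and `D(ab; cd)` fails whenever `a, b, c, d` lie in four different sectors. -/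
def IsSplitting (𝒟 : DSet Ω) (C : Set (Set Ω)) : Prop :=
  Setoid.IsPartition C ∧ 2 ≤ C.encard ∧
    (∀ S ∈ C, ∀ a ∈ S, ∀ b ∈ S, ∀ c ∉ S, ∀ d ∉ S, 𝒟.D a b c d) ∧
    (∀ S₁ ∈ C, ∀ S₂ ∈ C, ∀ S₃ ∈ C, ∀ S₄ ∈ C,
      S₁ ≠ S₂ → S₁ ≠ S₃ → S₁ ≠ S₄ → S₂ ≠ S₃ → S₂ ≠ S₄ → S₃ ≠ S₄ →
      ∀ a ∈ S₁, ∀ b ∈ S₂, ∀ c ∈ S₃, ∀ d ∈ S₄, ¬ 𝒟.D a b c d)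

/-- A node splitting: more than two sectors. -/
def IsNodeSplitting (𝒟 : DSet Ω) (C : Set (Set Ω)) : Prop :=
  𝒟.IsSplitting C ∧ 2 < C.encard

/-- An edge splitting: exactly two sectors. -/
def IsEdgeSplitting (𝒟 : DSet Ω) (C : Set (Set Ω)) : Prop :=
  𝒟.IsSplitting C ∧ C.encard = 2

/-- A true edge splitting: an edge splitting which cannot be refined to a node splitting, and
none of whose sectors is a singleton. -/
def IsTrueEdgeSplitting (𝒟 : DSet Ω) (C : Set (Set Ω)) : Prop :=
  𝒟.IsEdgeSplitting C ∧
    (¬ ∃ N : Set (Set Ω), 𝒟.IsNodeSplitting N ∧ ∀ S ∈ N, ∃ T ∈ C, S ⊆ T) ∧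
    ∀ S ∈ C, S.encard ≠ 1

/-- An automorphism of the structure `(Ω; D, P)`. -/
def IsAut (𝒟 : DSet Ω) (P : Set Ω) (σ : Equiv.Perm Ω) : Prop :=
  (∀ w x y z, 𝒟.D (σ w) (σ x) (σ y) (σ z) ↔ 𝒟.D w x y z) ∧ ∀ x, σ x ∈ P ↔ x ∈ P

/-- An isomorphism between the substructures of `(Ω; D, P)` with underlying sets `A` and `B`. -/
def IsPartialIso (𝒟 : DSet Ω) (P A B : Set Ω) (φ : A ≃ B) : Prop :=
  (∀ w x y z : A, 𝒟.D (φ w) (φ x) (φ y) (φ z) ↔ 𝒟.D w x y z) ∧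
    ∀ x : A, (φ x : Ω) ∈ P ↔ (x : Ω) ∈ P

/-- `P`-homogeneity: `P` is neither empty nor everything, and every isomorphism between
finite substructures of `(Ω; D, P)`, each containing an element of `P` and an element outside
`P`, extends to an automorphism of `(Ω; D, P)`. The language is relational, so the finitely
generated substructures are exactly the finite subsets. -/
def IsPHomogeneous (𝒟 : DSet Ω) (P : Set Ω) : Prop :=
  P ≠ ∅ ∧ P ≠ Set.univ ∧
    ∀ A B : Set Ω, A.Finite → B.Finite →
      (A ∩ P).Nonempty → (A \ P).Nonempty → (B ∩ P).Nonempty → (B \ P).Nonempty →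
      ∀ φ : A ≃ B, 𝒟.IsPartialIso P A B φ →
        ∃ σ : Equiv.Perm Ω, 𝒟.IsAut P σ ∧ ∀ a : A, σ a = φ a

end DSet

/-! Think of the elements as ends of a tree, with `D w x y z` for distinct elements saying that the
path from `w` to `x` is disjoint from the path from `y` to `z`. Three distinct elements determine a
node, whose sectors are the classes of `nodeSetoid`. Call membership in `P` the colour of an
element.

Suppose `Ω` is `P`-homogeneous. Distinct triples carry no `D`-information, and `D w x y z` fixes all
of `D` on four distinct elements. So a tuple of three or four elements showing both colours can be
moved to any tuple of the same shape and colours. Properness provides some quadruple with an element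
between its sides, and moving it gives density (`IsPHomogeneous.isDense`). Moving two elements of
`P` and one outside carries every node splitting of `P` to every other (`IsPHomogeneous.mk_eq_mk`).
If an infinite sector has one colour, moving pairs into it forces `P` and its complement to form a
true edge splitting, unless one of them is a singleton (`IsPHomogeneous.isTrueEdgeSplitting`).

The converse is a back-and-forth argument (`IsPartialAut.exists_aut_of_extension`) resting on the
one-point extension `IsPartialAut.exists_insert`. A new element `c` joins the tree spanned by a
finite domain either inside an edge or in an unoccupied sector at a node. Density gives a point on
the corresponding edge of the image tree, and equality of sector numbers gives an unoccupied sector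
at the corresponding node. The three alternatives of the theorem, packaged as `Abundant`, ensure
that the point can be chosen with the colour of `c`. -/

namespace DSet

variable {Ω : Type u}

/-! ### Elementary consequences of the axioms. -/

section Basic

variable {𝒟 : DSet Ω} {a b c d u v w x y z : Ω}

theorem D.left (h : 𝒟.D w x y z) : 𝒟.D x w y z := (𝒟.d1 _ _ _ _ h).1

theorem D.symm (h : 𝒟.D w x y z) : 𝒟.D y z w x := (𝒟.d1 _ _ _ _ h).2

theorem D.right (h : 𝒟.D w x y z) : 𝒟.D w x z y := h.symm.left.symm

theorem D.not_cross (h : 𝒟.D w x y z) : ¬ 𝒟.D w y x z := 𝒟.d2 _ _ _ _ h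

theorem D.not_cross' (h : 𝒟.D w x y z) : ¬ 𝒟.D w z x y := fun h' => h.right.not_cross h'

theorem D.ne₁₃ (h : 𝒟.D w x y z) : w ≠ y := by
  rintro rfl
  by_cases hx : x = w
  · subst hx
    exact h.left.not_cross h
  by_cases hz : z = w
  · subst hz
    exact h.left.not_cross h.left
  exact (𝒟.d4 x z w hx hz).not_cross h.left.right

theorem D.ne₁₄ (h : 𝒟.D w x y z) : w ≠ z := h.right.ne₁₃

theorem D.ne₂₃ (h : 𝒟.D w x y z) : x ≠ y := h.left.ne₁₃

theorem D.ne₂₄ (h : 𝒟.D w x y z) : x ≠ z := h.left.ne₁₄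

theorem D_diag_iff : 𝒟.D c c x y ↔ x ≠ c ∧ y ≠ c :=
  ⟨fun h => ⟨h.ne₁₃.symm, h.ne₁₄.symm⟩, fun h => (𝒟.d4 x y c h.1 h.2).symm⟩

theorem D.trans (h : 𝒟.D w x y z) (h' : 𝒟.D w x z v) : 𝒟.D w x y v := by
  by_contra hn
  have h1 : 𝒟.D v x y z := (𝒟.d3 _ _ _ _ h v).resolve_right hn
  have h2 : 𝒟.D y x v z := (𝒟.d3 _ _ _ _ h'.right y).resolve_right fun h => hn h.right
  exact h1.left.not_cross h2.left

/-- Every further element lies on one of the two sides of a quadruple. -/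
theorem D.side (h : 𝒟.D w x y z) (v : Ω) :
    (𝒟.D w x y v ∧ 𝒟.D w x z v) ∨ (𝒟.D w v y z ∧ 𝒟.D x v y z) := by
  by_cases hv : 𝒟.D w x y v
  · exact Or.inl ⟨hv, h.right.trans hv⟩
  · exact Or.inr ⟨((𝒟.d3 _ _ _ _ h.left v).resolve_right fun h => hv h.left).left,
      ((𝒟.d3 _ _ _ _ h v).resolve_right hv).left⟩

/-- Sectors at the nodes on the path from `u` to `x` are nested. -/
theorem D.nested (h : 𝒟.D w u z x) (h' : 𝒟.D z u v x) : 𝒟.D w u v x := by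
  rcases 𝒟.d3 _ _ _ _ h'.right w with h1 | h1
  · exact h1.right
  · exact absurd h1.left.right (fun h2 => h.left.not_cross h2)

end Basic

/-! ### Splittings as equivalence relations, and the node of three elements. -/

/-- An equivalence relation whose classes satisfy the defining conditions of a splitting. -/
structure IsSplit (𝒟 : DSet Ω) (s : Setoid Ω) : Prop where
  sep : ∀ u v x y, s u v → ¬ s u x → ¬ s u y → 𝒟.D u v x y
  rel_or_rel : ∀ u v x y, 𝒟.D u v x y → s u v ∨ s x y

/-- The elements `u`, `v` lie in the same sector at the node determined by `a`, `b`, `c`. -/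
def NodeRel (𝒟 : DSet Ω) (a b c u v : Ω) : Prop :=
  𝒟.D u v a b ∨ 𝒟.D u v b c ∨ 𝒟.D u v a c

section Node

variable {𝒟 : DSet Ω} {a b c d u v w x y z : Ω}

theorem NodeRel.rotate (h : 𝒟.NodeRel a b c u v) : 𝒟.NodeRel b c a u v := by
  rcases h with h | h | h
  · exact Or.inr (Or.inr h.right)
  · exact Or.inl h
  · exact Or.inr (Or.inl h.right)

theorem NodeRel.symm (h : 𝒟.NodeRel a b c u v) : 𝒟.NodeRel a b c v u := by
  rcases h with h | h | h
  · exact Or.inl h.left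
  · exact Or.inr (Or.inl h.left)
  · exact Or.inr (Or.inr h.left)

theorem NodeRel.refl (hab : a ≠ b) (hac : a ≠ c) (hbc : b ≠ c) (u : Ω) :
    𝒟.NodeRel a b c u u := by
  simp only [NodeRel, D_diag_iff]
  grind

theorem D.trans_left (h : 𝒟.D u v x y) (h' : 𝒟.D v w x y) : 𝒟.D u w x y :=
  (h.symm.trans h'.symm).symm

theorem NodeRel.trans_aux (h : 𝒟.D u v a b) (h' : 𝒟.NodeRel a b c v w) :
    𝒟.NodeRel a b c u w := by
  rcases h' with h' | h' | h'
  · exact Or.inl (h.trans_left h')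
  · rcases h.side c with ⟨-, h2⟩ | ⟨-, h2⟩
    -- If `c` lies with `a`, `b`, transitivity applies directly; if it lies with `u`, `v`, then `a`
    -- must be on the side of `b`, `c` as seen from `v`, `w`.
    · exact Or.inr (Or.inl (h2.trans_left h'))
    · rcases h'.side a with ⟨h3, -⟩ | ⟨h3, -⟩
      · exact Or.inl (h.trans_left h3.right)
      · exact absurd h3.right (h2.not_cross)
  · rcases h.side c with ⟨h2, -⟩ | ⟨-, h2⟩
    · exact Or.inr (Or.inr (h2.trans_left h'))
    · rcases h'.side b with ⟨h3, -⟩ | ⟨h3, -⟩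
      · exact Or.inl (h.trans_left h3)
      · exact absurd h3.right (h2.right.not_cross)

theorem NodeRel.trans (h : 𝒟.NodeRel a b c u v) (h' : 𝒟.NodeRel a b c v w) :
    𝒟.NodeRel a b c u w := by
  rcases h with h | h | h
  · exact NodeRel.trans_aux h h'
  · exact (NodeRel.trans_aux h h'.rotate).rotate.rotate
  · exact (NodeRel.trans_aux h.right h'.rotate.rotate).rotate

/-- The equivalence relation whose classes are the sectors at the node of `a`, `b`, `c`. -/
def nodeSetoid (𝒟 : DSet Ω) (hab : a ≠ b) (hac : a ≠ c) (hbc : b ≠ c) : Setoid Ω where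
  r := 𝒟.NodeRel a b c
  iseqv := ⟨NodeRel.refl hab hac hbc, NodeRel.symm, NodeRel.trans⟩

theorem isSplit_nodeSetoid (hab : a ≠ b) (hac : a ≠ c) (hbc : b ≠ c) :
    𝒟.IsSplit (𝒟.nodeSetoid hab hac hbc) where
  sep u v x y h hx hy := by
    have key : ∀ {p q : Ω}, (∀ {u v}, 𝒟.D u v p q → 𝒟.NodeRel a b c u v) →
        𝒟.D u v p q → 𝒟.D u v x y := fun {p q} hR h => by
      have h1 : ∀ {x}, ¬ 𝒟.NodeRel a b c u x → 𝒟.D u v p x := fun {x} hx => by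
        rcases h.side x with ⟨h2, -⟩ | ⟨h2, -⟩
        · exact h2
        · exact absurd (hR h2) hx
      exact (h1 hx).right.trans (h1 hy)
    rcases h with h | h | h
    · exact key Or.inl h
    · exact key (fun h => Or.inr (Or.inl h)) h
    · exact key (fun h => Or.inr (Or.inr h)) h
  rel_or_rel u v x y h := by
    change 𝒟.NodeRel a b c u v ∨ 𝒟.NodeRel a b c x y
    -- Each of `a`, `b`, `c` lies on one of the two sides, so two of them share a side, and these
    -- two are separated from the pair on the other side.
    have key : ∀ t, 𝒟.D u v x t ∨ 𝒟.D x y u t := fun t => by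
      rcases h.side t with ⟨h, -⟩ | ⟨h, -⟩
      · exact Or.inl h
      · exact Or.inr h.symm
    have k1 : ∀ {u v x s t}, 𝒟.D u v x s → 𝒟.D u v x t → 𝒟.D u v s t :=
      fun h h' => h.right.trans h'
    unfold NodeRel
    rcases key a with h1 | h1 <;> rcases key b with h2 | h2 <;> rcases key c with h3 | h3 <;> grind

theorem not_nodeRel : ¬ 𝒟.NodeRel a b c a b := by
  rintro (h | h | h)
  · exact h.ne₁₃ rfl
  · exact h.ne₂₃ rfl
  · exact h.ne₁₃ rfl

end Node

namespace IsSplit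

variable {𝒟 : DSet Ω} {s : Setoid Ω} {a b c d u v w x y z : Ω}

theorem rel_of_D (hs : 𝒟.IsSplit s) (hbc : ¬ s b c) (h : 𝒟.D u v b c) : s u v :=
  (hs.rel_or_rel _ _ _ _ h).resolve_right hbc

theorem rel_iff_D (hs : 𝒟.IsSplit s) (hab : ¬ s a b) (hac : ¬ s a c) (hbc : ¬ s b c) :
    s u a ↔ 𝒟.D u a b c :=
  ⟨fun h => (hs.sep a u b c (s.symm h) hab hac).left, fun h => hs.rel_of_D hbc h⟩

/-- Any three inequivalent elements recover the whole relation. A node can thus be re-based at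
convenient elements, and partial isomorphisms transport it. -/
theorem rel_iff_nodeRel (hs : 𝒟.IsSplit s) (hab : ¬ s a b) (hac : ¬ s a c) (hbc : ¬ s b c) :
    s u v ↔ 𝒟.NodeRel a b c u v := by
  constructor
  · intro h
    by_cases ha : s u a
    · exact Or.inr (Or.inl (hs.sep _ _ _ _ h (fun h => hab (s.trans (s.symm ha) h))
        fun h => hac (s.trans (s.symm ha) h)))
    by_cases hb : s u b
    · exact Or.inr (Or.inr (hs.sep _ _ _ _ h ha fun h => hbc (s.trans (s.symm hb) h)))
    exact Or.inl (hs.sep _ _ _ _ h ha hb)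
  · rintro (h | h | h)
    · exact hs.rel_of_D hab h
    · exact hs.rel_of_D hbc h
    · exact hs.rel_of_D hac h

theorem not_rel_nodeSetoid (hab : a ≠ b) (hac : a ≠ c) (hbc : b ≠ c) :
    ¬ 𝒟.nodeSetoid hab hac hbc a b ∧ ¬ 𝒟.nodeSetoid hab hac hbc a c ∧
      ¬ 𝒟.nodeSetoid hab hac hbc b c :=
  ⟨not_nodeRel, fun h => not_nodeRel (NodeRel.rotate (NodeRel.rotate (NodeRel.symm h))),
    fun h => not_nodeRel (NodeRel.rotate h)⟩

/-- Branching inside a class looks the same from every element outside it. -/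
theorem D_of_D (hs : 𝒟.IsSplit s) (hxy : s x y) (hc : ¬ s x c) (ht : ¬ s x u)
    (h : 𝒟.D c x y z) : 𝒟.D u x y z := by
  rcases 𝒟.d3 _ _ _ _ h u with h1 | h1
  · exact h1
  · exact absurd h1.left (hs.sep _ _ _ _ hxy hc ht).not_cross

theorem restrict (hs : 𝒟.IsSplit s) (Q : Set Ω) :
    (𝒟.restrict Q).IsSplit (s.comap Subtype.val) where
  sep u v x y h hx hy := hs.sep u v x y h hx hy
  rel_or_rel u v x y h := hs.rel_or_rel u v x y h

theorem isSplitting_classes (hs : 𝒟.IsSplit s) (hab : ¬ s a b) :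
    𝒟.IsSplitting s.classes := by
  refine ⟨Setoid.isPartition_classes s, ?_, ?_, ?_⟩
  · have h : ({{x | s x a}, {x | s x b}} : Set (Set Ω)) ⊆ s.classes := by
      rintro _ (rfl | rfl)
      · exact s.mem_classes a
      · exact s.mem_classes b
    rw [← Set.encard_pair (x := {x | s x a}) (y := {x | s x b})]
    · exact Set.encard_le_encard h
    · intro h
      exact hab (h.subset (s.refl a) : s a b)
  · rintro _ ⟨e, rfl⟩ u hu v hv x hx y hy
    exact hs.sep u v x y (s.trans hu (s.symm hv)) (fun h => hx (s.trans (s.symm h) hu))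
      fun h => hy (s.trans (s.symm h) hu)
  · rintro _ ⟨e, rfl⟩ _ ⟨f, rfl⟩ _ ⟨g, rfl⟩ _ ⟨h, rfl⟩ h1 h2 h3 h4 h5 h6 u hu v hv x hx y hy hD
    rcases hs.rel_or_rel _ _ _ _ hD with h' | h'
    · exact h1 (s.eq_of_mem_classes (s.mem_classes e) hu (s.mem_classes f)
        (s.trans h' hv))
    · exact h6 (s.eq_of_mem_classes (s.mem_classes g) hx (s.mem_classes h) (s.trans h' hy))

theorem isNodeSplitting_classes (hs : 𝒟.IsSplit s) (hab : ¬ s a b) (hac : ¬ s a c)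
    (hbc : ¬ s b c) : 𝒟.IsNodeSplitting s.classes := by
  refine ⟨hs.isSplitting_classes hab, ?_⟩
  have h : ({{x | s x a}, {x | s x b}, {x | s x c}} : Set (Set Ω)) ⊆ s.classes := by
    rintro _ (rfl | rfl | rfl)
    · exact s.mem_classes a
    · exact s.mem_classes b
    · exact s.mem_classes c
  have h3 : Set.encard ({{x | s x a}, {x | s x b}, {x | s x c}} : Set (Set Ω)) = 3 := by
    rw [Set.encard_eq_three]
    exact ⟨{x | s x a}, {x | s x b}, {x | s x c}, fun h => hab (h.subset (s.refl a)), fun h => hac (h.subset (s.refl a)),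
      fun h => hbc (h.subset (s.refl b)), rfl⟩
  exact lt_of_lt_of_le (by rw [h3]; decide) (Set.encard_le_encard h)

end IsSplit

/-- The equivalence relation of a splitting. -/
theorem IsSplitting.isSplit {𝒟 : DSet Ω} {C : Set (Set Ω)} (hC : 𝒟.IsSplitting C) :
    𝒟.IsSplit (Setoid.mkClasses C hC.1.2) := by
  obtain ⟨hp, -, h1, h2⟩ := hC
  have hr : ∀ {u v}, Setoid.mkClasses C hp.2 u v ↔ ∃ S ∈ C, u ∈ S ∧ v ∈ S := by
    intro u v
    constructor
    · intro h
      obtain ⟨S, ⟨hS, hu⟩, -⟩ := hp.2 u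
      exact ⟨S, hS, hu, h S hS hu⟩
    · rintro ⟨S, hS, hu, hv⟩ T hT huT
      rwa [(hp.2 u).unique ⟨hT, huT⟩ ⟨hS, hu⟩]
  have sep : ∀ u v x y, Setoid.mkClasses C hp.2 u v → ¬ Setoid.mkClasses C hp.2 u x →
      ¬ Setoid.mkClasses C hp.2 u y → 𝒟.D u v x y := by
    intro u v x y huv hx hy
    obtain ⟨S, hS, hu, hv⟩ := hr.1 huv
    exact h1 S hS u hu v hv x (fun h => hx (hr.2 ⟨S, hS, hu, h⟩)) y
      fun h => hy (hr.2 ⟨S, hS, hu, h⟩)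
  refine ⟨sep, ?_⟩
  set s := Setoid.mkClasses C hp.2
  intro u v x y hD
  by_contra! hn
  obtain ⟨huv, hxy⟩ := hn
  have hne : ∀ {u v S T}, S ∈ C → u ∈ S → v ∈ T → ¬ s u v → S ≠ T := by
    rintro u v S _ hS hu hv h rfl
    exact h (hr.2 ⟨S, hS, hu, hv⟩)
  obtain ⟨Su, ⟨hSu, hu⟩, -⟩ := hp.2 u
  obtain ⟨Sv, ⟨hSv, hv⟩, -⟩ := hp.2 v
  obtain ⟨Sx, ⟨hSx, hx⟩, -⟩ := hp.2 x
  obtain ⟨Sy, ⟨hSy, hy⟩, -⟩ := hp.2 y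
  -- If neither pair is equivalent, an equivalence across the two pairs would give a crossing
  -- quadruple. So the four sectors are different, which condition (ii) forbids.
  have key : ∀ {u v x y}, 𝒟.D u v x y → ¬ s u v → ¬ s x y → ¬ s u x := fun h h1 h2 h3 =>
    h.not_cross (sep _ _ _ _ h3 h1 fun h4 => h2 (s.trans (s.symm h3) h4))
  have hux := key hD huv hxy
  have huy := key hD.right huv fun h => hxy (s.symm h)
  have hvx := key hD.left (fun h => huv (s.symm h)) hxy
  have hvy := key hD.left.right (fun h => huv (s.symm h)) fun h => hxy (s.symm h)
  exact h2 Su hSu Sv hSv Sx hSx Sy hSy (hne hSu hu hv huv) (hne hSu hu hx hux)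
    (hne hSu hu hy huy) (hne hSv hv hx hvx) (hne hSv hv hy hvy) (hne hSx hx hy hxy)
    u hu v hv x hx y hy hD

/-! ### Finite partial isomorphisms and their extensions by homogeneity. -/

/-- A partial isomorphism of `(Ω; D, P)`, given as a set of pairs. -/
structure IsPartialAut (𝒟 : DSet Ω) (P : Set Ω) (f : Set (Ω × Ω)) : Prop where
  mem : ∀ p ∈ f, (p.1 ∈ P ↔ p.2 ∈ P)
  eq : ∀ p ∈ f, ∀ q ∈ f, (p.1 = q.1 ↔ p.2 = q.2)
  map : ∀ p ∈ f, ∀ q ∈ f, ∀ r ∈ f, ∀ t ∈ f,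
    (𝒟.D p.1 q.1 r.1 t.1 ↔ 𝒟.D p.2 q.2 r.2 t.2)

section PartialAut

variable {𝒟 : DSet Ω} {P : Set Ω} {f : Set (Ω × Ω)} {c d : Ω}

theorem isPartialAut_empty : 𝒟.IsPartialAut P ∅ :=
  ⟨fun _ h => h.elim, fun _ h => h.elim, fun _ h => h.elim⟩

/-- By the symmetries of `D` the new element may be put in first position. Repetitions among the
entries are settled by the axioms, so only distinct triples need checking. -/
theorem IsPartialAut.insert_pair (hf : 𝒟.IsPartialAut P f) (hcd : c ∈ P ↔ d ∈ P)
    (hc : ∀ p ∈ f, c ≠ p.1) (hd : ∀ p ∈ f, d ≠ p.2)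
    (h : ∀ p ∈ f, ∀ q ∈ f, ∀ r ∈ f, p.1 ≠ q.1 → p.1 ≠ r.1 → q.1 ≠ r.1 →
      (𝒟.D c p.1 q.1 r.1 ↔ 𝒟.D d p.2 q.2 r.2)) :
    𝒟.IsPartialAut P (insert (c, d) f) := by
  have h' : ∀ p ∈ f, ∀ q ∈ f, ∀ r ∈ f, (𝒟.D c p.1 q.1 r.1 ↔ 𝒟.D d p.2 q.2 r.2) := by
    intro p hp q hq r hr
    by_cases hpq : p.1 = q.1
    · exact iff_of_false (fun h => h.ne₂₃ hpq) fun h => h.ne₂₃ ((hf.eq p hp q hq).1 hpq)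
    by_cases hpr : p.1 = r.1
    · exact iff_of_false (fun h => h.ne₂₄ hpr) fun h => h.ne₂₄ ((hf.eq p hp r hr).1 hpr)
    by_cases hqr : q.1 = r.1
    · rw [← hqr, ← (hf.eq q hq r hr).1 hqr]
      exact iff_of_true (𝒟.d4 _ _ _ (hc q hq) hpq)
        (𝒟.d4 _ _ _ (hd q hq) fun h => hpq ((hf.eq p hp q hq).2 h))
    exact h p hp q hq r hr hpq hpr hqr
  have e13 : ∀ {a x y}, ¬ 𝒟.D a x a y := fun h => h.ne₁₃ rfl
  have e14 : ∀ {a x y}, ¬ 𝒟.D a x y a := fun h => h.ne₁₄ rfl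
  have e23 : ∀ {a x y}, ¬ 𝒟.D x a a y := fun h => h.ne₂₃ rfl
  have e24 : ∀ {a x y}, ¬ 𝒟.D x a y a := fun h => h.ne₂₄ rfl
  have cl : ∀ {a b x y}, 𝒟.D a b x y ↔ 𝒟.D b a x y := ⟨D.left, D.left⟩
  have cs : ∀ {a b x y}, 𝒟.D a b x y ↔ 𝒟.D x y a b := ⟨D.symm, D.symm⟩
  have diag : ∀ p ∈ f, ∀ q ∈ f, (𝒟.D c c p.1 q.1 ↔ 𝒟.D d d p.2 q.2) := fun p hp q hq =>
    iff_of_true (D_diag_iff.2 ⟨(hc p hp).symm, (hc q hq).symm⟩)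
      (D_diag_iff.2 ⟨(hd p hp).symm, (hd q hq).symm⟩)
  refine ⟨?_, ?_, ?_⟩
  · rintro p (rfl | hp)
    · exact hcd
    · exact hf.mem p hp
  · rintro p (rfl | hp) q (rfl | hq)
    · simp
    · exact iff_of_false (hc q hq) (hd q hq)
    · exact iff_of_false (hc p hp).symm (hd p hp).symm
    · exact hf.eq p hp q hq
  · rintro p (rfl | hp) q (rfl | hq) r (rfl | hr) t (rfl | ht)
    all_goals first
      | exact iff_of_false e13 e13
      | exact iff_of_false e14 e14
      | exact iff_of_false e23 e23
      | exact iff_of_false e24 e24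
      | skip
    · exact diag r hr t ht
    · exact h' q hq r hr t ht
    · exact cl.trans ((h' p hp r hr t ht).trans cl)
    · exact cs.trans ((diag p hp q hq).trans cs)
    · exact cs.trans ((h' t ht p hp q hq).trans cs)
    · exact cs.trans (cl.trans ((h' r hr p hp q hq).trans (cl.trans cs)))
    · exact hf.map p hp q hq r hr t ht

theorem IsPartialAut.swap (hf : 𝒟.IsPartialAut P f) : 𝒟.IsPartialAut P (Prod.swap '' f) := by
  refine ⟨?_, ?_, ?_⟩
  · rintro _ ⟨p, hp, rfl⟩
    exact (hf.mem p hp).symm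
  · rintro _ ⟨p, hp, rfl⟩ _ ⟨q, hq, rfl⟩
    exact (hf.eq p hp q hq).symm
  · rintro _ ⟨p, hp, rfl⟩ _ ⟨q, hq, rfl⟩ _ ⟨r, hr, rfl⟩ _ ⟨t, ht, rfl⟩
    exact (hf.map p hp q hq r hr t ht).symm

theorem IsPHomogeneous.exists_aut (h : 𝒟.IsPHomogeneous P) (hf : 𝒟.IsPartialAut P f)
    (hfin : f.Finite) (hbi : ∃ p ∈ f, ∃ q ∈ f, ¬ (p.1 ∈ P ↔ q.1 ∈ P)) :
    ∃ σ : Equiv.Perm Ω, 𝒟.IsAut P σ ∧ ∀ p ∈ f, σ p.1 = p.2 := by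
  have hfst : Set.InjOn Prod.fst f := fun p hp q hq h => Prod.ext h ((hf.eq p hp q hq).1 h)
  have hsnd : Set.InjOn Prod.snd f := fun p hp q hq h => Prod.ext ((hf.eq p hp q hq).2 h) h
  let e₁ := Equiv.Set.imageOfInjOn Prod.fst f hfst
  let e₂ := Equiv.Set.imageOfInjOn Prod.snd f hsnd
  have he : ∀ a : Prod.fst '' f, (e₁.symm a).1.1 = a := fun a =>
    congrArg Subtype.val (e₁.apply_symm_apply a)
  obtain ⟨p, hp, q, hq, hpP, hqP⟩ : ∃ p ∈ f, ∃ q ∈ f, p.1 ∈ P ∧ q.1 ∉ P := by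
    obtain ⟨p, hp, q, hq, h⟩ := hbi
    by_cases hpP : p.1 ∈ P
    · exact ⟨p, hp, q, hq, hpP, fun hqP => h (iff_of_true hpP hqP)⟩
    · exact ⟨q, hq, p, hp, by tauto, hpP⟩
  obtain ⟨σ, hσ, hσe⟩ := h.2.2 (Prod.fst '' f) (Prod.snd '' f) (hfin.image _) (hfin.image _)
    ⟨p.1, ⟨p, hp, rfl⟩, hpP⟩ ⟨q.1, ⟨q, hq, rfl⟩, hqP⟩
    ⟨p.2, ⟨p, hp, rfl⟩, (hf.mem p hp).1 hpP⟩ ⟨q.2, ⟨q, hq, rfl⟩, fun h => hqP ((hf.mem q hq).2 h)⟩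
    (e₁.symm.trans e₂)
    ⟨fun w x y z => by
      have := hf.map _ (e₁.symm w).2 _ (e₁.symm x).2 _ (e₁.symm y).2 _ (e₁.symm z).2
      rw [he, he, he, he] at this
      exact this.symm, fun x => by
      have := hf.mem _ (e₁.symm x).2
      rw [he] at this
      exact this.symm⟩
  refine ⟨σ, hσ, fun p hp => ?_⟩
  have h1 := hσe (e₁ ⟨p, hp⟩)
  rw [Equiv.trans_apply, Equiv.symm_apply_apply] at h1
  exact h1

theorem IsPHomogeneous.compl (h : 𝒟.IsPHomogeneous P) : 𝒟.IsPHomogeneous Pᶜ := by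
  refine ⟨fun h0 => h.2.1 (Set.compl_empty_iff.1 h0), fun h0 => h.1 (Set.compl_univ_iff.1 h0), ?_⟩
  intro A B hA hB h1 h2 h3 h4 φ hφ
  rw [Set.sdiff_compl] at h2 h4
  obtain ⟨σ, hσ, hσφ⟩ := h.2.2 A B hA hB h2 h1 h4 h3 φ ⟨hφ.1, fun x => not_iff_not.1 (hφ.2 x)⟩
  exact ⟨σ, ⟨hσ.1, fun x => not_iff_not.2 (hσ.2 x)⟩, hσφ⟩

/-- On three elements `D` depends only on which entries coincide, so any colour-preserving bijection
is a partial isomorphism. -/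
theorem IsPHomogeneous.exists_aut_three (h : 𝒟.IsPHomogeneous P) {p q r p' q' r' : Ω}
    (hp : p ∈ P) (hq : q ∈ P) (hpq : p ≠ q) (hr : r ∉ P) (hp' : p' ∈ P) (hq' : q' ∈ P)
    (hpq' : p' ≠ q') (hr' : r' ∉ P) :
    ∃ σ : Equiv.Perm Ω, 𝒟.IsAut P σ ∧ σ p = p' ∧ σ q = q' ∧ σ r = r' := by
  have n1 : p ≠ r := fun h => hr (h ▸ hp)
  have n2 : q ≠ r := fun h => hr (h ▸ hq)
  have n3 : p' ≠ r' := fun h => hr' (h ▸ hp')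
  have n4 : q' ≠ r' := fun h => hr' (h ▸ hq')
  have h1 : 𝒟.IsPartialAut P {(p, p'), (q, q'), (r, r')} := by
    rw [← insert_empty_eq (r, r')]
    refine ((isPartialAut_empty.insert_pair ?_ ?_ ?_ ?_).insert_pair ?_ ?_ ?_ ?_).insert_pair ?_ ?_ ?_ ?_ <;>
      simp_all
  obtain ⟨σ, hσ, h2⟩ := h.exists_aut h1 (by simp) ⟨(p, p'), by simp, (r, r'), by simp, by
    simp [hp, hr]⟩
  exact ⟨σ, hσ, h2 (p, p') (by simp), h2 (q, q') (by simp), h2 (r, r') (by simp)⟩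

/-- One instance of `D` on four distinct elements excludes the other two pairings, hence determines
`D` on all of them. -/
theorem IsPHomogeneous.exists_aut_four (h : 𝒟.IsPHomogeneous P) {w x y z w' x' y' z' : Ω}
    (hD : 𝒟.D w x y z) (hD' : 𝒟.D w' x' y' z') (hwx : w ≠ x) (hyz : y ≠ z) (hwx' : w' ≠ x')
    (hyz' : y' ≠ z') (hw : w ∈ P ↔ w' ∈ P) (hx : x ∈ P ↔ x' ∈ P) (hy : y ∈ P ↔ y' ∈ P)
    (hz : z ∈ P ↔ z' ∈ P)
    (hbi : ¬ ((w ∈ P ↔ x ∈ P) ∧ (w ∈ P ↔ y ∈ P) ∧ (w ∈ P ↔ z ∈ P))) :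
    ∃ σ : Equiv.Perm Ω, 𝒟.IsAut P σ ∧ σ w = w' ∧ σ x = x' ∧ σ y = y' ∧ σ z = z' := by
  have n1 := hD.ne₁₃
  have n2 := hD.ne₁₄
  have n3 := hD.ne₂₃
  have n4 := hD.ne₂₄
  have n1' := hD'.ne₁₃
  have n2' := hD'.ne₁₄
  have n3' := hD'.ne₂₃
  have n4' := hD'.ne₂₄
  have h1 : 𝒟.IsPartialAut P {(w, w'), (x, x'), (y, y'), (z, z')} := by
    rw [← insert_empty_eq (z, z')]
    refine (((isPartialAut_empty.insert_pair ?_ ?_ ?_ ?_).insert_pair ?_ ?_ ?_ ?_).insert_pair ?_ ?_ ?_ ?_).insert_pair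
      ?_ ?_ ?_ ?_
    all_goals try simp_all; done
    clear hwx hyz hwx' hyz' hw hx hy hz hbi n1 n2 n3 n4 n1' n2' n3' n4'
    simp only [insert_empty_eq, Set.mem_insert_iff, Set.mem_singleton_iff]
    rintro p (rfl | rfl | rfl) q (rfl | rfl | rfl) r (rfl | rfl | rfl) e1 e2 e3
    all_goals first
      | exact absurd rfl e1
      | exact absurd rfl e2
      | exact absurd rfl e3
      | exact iff_of_true hD hD'
      | exact iff_of_true hD.right hD'.right
      | exact iff_of_false hD.not_cross hD'.not_cross
      | exact iff_of_false hD.not_cross' hD'.not_cross'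
      | exact iff_of_false (fun h => hD.not_cross h.right) (fun h => hD'.not_cross h.right)
      | exact iff_of_false (fun h => hD.not_cross' h.right) (fun h => hD'.not_cross' h.right)
  obtain ⟨σ, hσ, h2⟩ := h.exists_aut h1 (by simp) (by
    by_contra! h3
    exact hbi ⟨h3 (w, w') (by simp) (x, x') (by simp), h3 (w, w') (by simp) (y, y') (by simp),
      h3 (w, w') (by simp) (z, z') (by simp)⟩)
  exact ⟨σ, hσ, h2 (w, w') (by simp), h2 (x, x') (by simp), h2 (y, y') (by simp),
    h2 (z, z') (by simp)⟩

end PartialAut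

/-! ### Homogeneity implies density. -/

/-- The element `v` branches off strictly between the two sides of the quadruple. -/
def Between (𝒟 : DSet Ω) (w x y z v : Ω) : Prop :=
  𝒟.D v x y z ∧ 𝒟.D w v y z ∧ 𝒟.D w x v z ∧ 𝒟.D w x y v

section Dense

variable {𝒟 : DSet Ω} {P : Set Ω} {v w x y z : Ω}

theorem Between.left (h : 𝒟.Between w x y z v) : 𝒟.Between x w y z v :=
  ⟨h.2.1.left, h.1.left, h.2.2.1.left, h.2.2.2.left⟩

theorem Between.symm (h : 𝒟.Between w x y z v) : 𝒟.Between y z w x v :=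
  ⟨h.2.2.1.symm, h.2.2.2.symm, h.1.symm, h.2.1.symm⟩

theorem D.of_cross (h : 𝒟.D w x y z) (h' : 𝒟.D v x w y) : 𝒟.D w v y z ∧ 𝒟.D v x y z := by
  rcases h.side v with ⟨h1, -⟩ | ⟨h1, h2⟩
  · exact absurd h'.left.right (fun h2 => h1.left.not_cross' h2.right)
  · exact ⟨h1, h2.left⟩

theorem D.between_of_cross (h : 𝒟.D w x y z) (h' : 𝒟.D v x w y) : 𝒟.Between v x y z w :=
  have h1 := h.of_cross h'
  ⟨h, h1.1.left, h'.trans h1.2, h'.right⟩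

/-- If `u` does not branch off with `w` before `x` does, the segment from `u`, `w` to `y`, `z` is
part of the one from `w`, `x` to `y`, `z`. -/
theorem Between.of_not_cross {u : Ω} (hv : 𝒟.Between u w y z v) (hD : 𝒟.D w x y z)
    (hn : ¬ 𝒟.D u w x y) : 𝒟.Between w x y z v := by
  have h1 : 𝒟.D w x v y := by
    rcases hv.2.2.2.side x with ⟨h1, -⟩ | ⟨-, h1⟩
    · exact absurd h1.right hn
    · exact h1.right
  exact ⟨hv.1.trans_left hD, hv.1.left, h1.trans hD, h1.right⟩

theorem IsAut.between_iff {σ : Equiv.Perm Ω} (hσ : 𝒟.IsAut P σ) :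
    𝒟.Between (σ w) (σ x) (σ y) (σ z) (σ v) ↔ 𝒟.Between w x y z v := by
  simp only [Between, hσ.1]

theorem IsPHomogeneous.exists_between_of_between (h : 𝒟.IsPHomogeneous P) {w' x' y' z' v' : Ω}
    (hD : 𝒟.D w x y z) (hD' : 𝒟.D w' x' y' z') (hwx : w ≠ x) (hyz : y ≠ z) (hwx' : w' ≠ x')
    (hyz' : y' ≠ z') (hw : w ∈ P ↔ w' ∈ P) (hx : x ∈ P ↔ x' ∈ P) (hy : y ∈ P ↔ y' ∈ P)
    (hz : z ∈ P ↔ z' ∈ P)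
    (hbi : ¬ ((w ∈ P ↔ x ∈ P) ∧ (w ∈ P ↔ y ∈ P) ∧ (w ∈ P ↔ z ∈ P)))
    (hv : 𝒟.Between w' x' y' z' v') : ∃ v, 𝒟.Between w x y z v := by
  obtain ⟨σ, hσ, rfl, rfl, rfl, rfl⟩ :=
    h.exists_aut_four hD hD' hwx hyz hwx' hyz' hw hx hy hz hbi
  obtain ⟨v, rfl⟩ := σ.surjective v'
  exact ⟨v, hσ.between_iff.1 hv⟩

/-- Here `w` itself lies between `w'`, `x` and `y`, `z`. The two quadruples have the same colours,
so the first also has an element between its sides. -/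
theorem IsPHomogeneous.exists_between_of_cross (h : 𝒟.IsPHomogeneous P) {w' : Ω}
    (hD : 𝒟.D w x y z) (hwx : w ≠ x) (hyz : y ≠ z)
    (hbi : ¬ ((w ∈ P ↔ x ∈ P) ∧ (w ∈ P ↔ y ∈ P) ∧ (w ∈ P ↔ z ∈ P)))
    (hw' : w ∈ P ↔ w' ∈ P) (hne : w' ≠ x) (hc : 𝒟.D w' x w y) :
    ∃ v, 𝒟.Between w x y z v :=
  h.exists_between_of_between hD (hD.of_cross hc).2 hwx hyz hne hyz hw' Iff.rfl Iff.rfl Iff.rfl hbi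
    (hD.between_of_cross hc)

theorem IsPHomogeneous.exists_between_of_same (h : 𝒟.IsPHomogeneous P) (hproper : 𝒟.IsProper)
    (hD : 𝒟.D w x y z) (hwx : w ≠ x) (hyz : y ≠ z)
    (hbi : ¬ ((w ∈ P ↔ x ∈ P) ∧ (w ∈ P ↔ y ∈ P) ∧ (w ∈ P ↔ z ∈ P)))
    (hs : w ∈ P ↔ x ∈ P) : ∃ v, 𝒟.Between w x y z v := by
  obtain ⟨u, hux, hu⟩ := hproper.2 w y x hD.ne₁₃ hwx hD.ne₂₃.symm
  by_cases huP : w ∈ P ↔ u ∈ P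
  · exact h.exists_between_of_cross hD hwx hyz hbi huP hux hu.symm.left
  have hc : 𝒟.D u x w y := hu.symm.left
  -- Since `w` and `x` share a colour, `(u, w, y, z)` is conjugate to `(u, x, y, z)`, which has `w`
  -- between its sides.
  obtain ⟨v, hv⟩ := h.exists_between_of_between (hD.of_cross hc).1.left (hD.of_cross hc).2
    hc.ne₁₃ hyz hux hyz Iff.rfl hs Iff.rfl Iff.rfl (fun h => huP h.1.symm) (hD.between_of_cross hc)
  exact ⟨v, hv.of_not_cross hD hc.not_cross⟩

theorem IsPHomogeneous.exists_between_of_bichromatic (h : 𝒟.IsPHomogeneous P)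
    (hproper : 𝒟.IsProper) (hD : 𝒟.D w x y z) (hwx : w ≠ x) (hyz : y ≠ z)
    (hbi : ¬ ((w ∈ P ↔ x ∈ P) ∧ (w ∈ P ↔ y ∈ P) ∧ (w ∈ P ↔ z ∈ P))) :
    ∃ v, 𝒟.Between w x y z v := by
  by_cases hs : w ∈ P ↔ x ∈ P
  · exact h.exists_between_of_same hproper hD hwx hyz hbi hs
  by_cases hs' : y ∈ P ↔ z ∈ P
  · obtain ⟨v, hv⟩ := h.exists_between_of_same hproper hD.symm hyz hwx (by tauto) hs'
    exact ⟨v, hv.symm⟩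
  wlog hwy : w ∈ P ↔ y ∈ P generalizing y z
  · obtain ⟨v, hv⟩ := this hD.right hyz.symm (by tauto) (by tauto) (by tauto)
    exact ⟨v, hv.symm.left.symm⟩
  obtain ⟨y', hy', hD'⟩ := hproper.2 z w y hD.ne₁₄.symm hyz.symm hD.ne₁₃
  have h1 : 𝒟.D w x y y' := (hD.symm.left.of_cross hD'.symm.left).2.symm.right
  -- Fix `w`, `y`, `y'` and move `x` to `z`, which has the same colour. The preimage of `x` is then
  -- an element of the colour of `x` that crosses as required.
  obtain ⟨σ, hσ, hw, hx, hy, -⟩ := h.exists_aut_four h1 hD'.left hwx hy'.symm hD.ne₁₄ hy'.symm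
    Iff.rfl (by tauto) Iff.rfl Iff.rfl (by tauto)
  obtain ⟨u, hu⟩ := σ.surjective x
  have h2 : 𝒟.D u w x y := by
    rw [← hσ.1, hw, hx, hy, hu]
    exact hD.left.right
  have huP : u ∈ P ↔ x ∈ P := by rw [← hσ.2, hu]
  obtain ⟨v, hv⟩ := h.exists_between_of_cross hD.left hwx.symm hyz (by tauto) huP.symm
    (fun h => by subst h; tauto) h2
  exact ⟨v, hv.left⟩

theorem IsPHomogeneous.isDense (h : 𝒟.IsPHomogeneous P) (hproper : 𝒟.IsProper) :
    𝒟.IsDense := by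
  refine ⟨le_trans (by decide) hproper.1, fun w x y z hD => ?_⟩
  have degen : ∀ {w y z}, 𝒟.D w w y z → ∃ v, 𝒟.Between w w y z v := by
    intro w y z hD
    by_cases hyz : y = z
    · subst hyz
      obtain ⟨v, hv⟩ : ∃ v, v ≠ w ∧ v ≠ y := by
        by_contra! hn
        have h1 : (Set.univ : Set Ω) ⊆ {w, y} := fun v _ => by
          by_cases hv : v = w
          · exact Or.inl hv
          · exact Or.inr (hn v hv)
        have h2 := (Set.encard_le_encard h1).trans (Set.encard_insert_le {y} w)
        rw [Set.encard_univ, Set.encard_singleton] at h2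
        exact absurd (hproper.1.trans h2) (by decide)
      have := hD.ne₁₃
      exact ⟨v, 𝒟.d4 _ _ _ hv.2 this, 𝒟.d4 _ _ _ this hv.2,
        D_diag_iff.2 ⟨hv.1, this.symm⟩, D_diag_iff.2 ⟨this.symm, hv.1⟩⟩
    · obtain ⟨v, hv, hD'⟩ := hproper.2 y z w hyz hD.ne₁₃.symm hD.ne₁₄.symm
      exact ⟨v, hD'.symm.left, hD'.symm, D_diag_iff.2 ⟨hv, hD.ne₁₄.symm⟩,
        D_diag_iff.2 ⟨hD.ne₁₃.symm, hv⟩⟩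
  change ∃ v, 𝒟.Between w x y z v
  by_cases hwx : w = x
  · subst hwx
    exact degen hD
  by_cases hyz : y = z
  · subst hyz
    obtain ⟨v, hv⟩ := degen hD.symm
    exact ⟨v, hv.symm⟩
  by_cases hbi : ¬ ((w ∈ P ↔ x ∈ P) ∧ (w ∈ P ↔ y ∈ P) ∧ (w ∈ P ↔ z ∈ P))
  · exact h.exists_between_of_bichromatic hproper hD hwx hyz hbi
  rw [not_not] at hbi
  -- For a quadruple of one colour, an element `p` of the other colour replaces an element on its
  -- own side, and the resulting shorter segment is treated by the two-coloured case.
  obtain ⟨p, hp⟩ : ∃ p, ¬ (w ∈ P ↔ p ∈ P) := by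
    by_contra! hn
    by_cases hw : w ∈ P
    · exact h.2.1 (Set.eq_univ_of_forall fun p => (hn p).1 hw)
    · exact h.1 (Set.eq_empty_of_forall_notMem fun p hp => hw ((hn p).2 hp))
  have key : ∀ {w x y z : Ω}, 𝒟.D w x y z → y ≠ z → ¬ (w ∈ P ↔ p ∈ P) → ¬ (x ∈ P ↔ p ∈ P) →
      𝒟.D w p y z ∧ 𝒟.D x p y z → ∃ v, 𝒟.Between w x y z v := by
    intro w x y z hD hyz hwp hxp ⟨h1, h2⟩
    by_cases hc : 𝒟.D p w x y
    · obtain ⟨v, hv⟩ := h.exists_between_of_bichromatic hproper h2.left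
        (by rintro rfl; exact hxp Iff.rfl) hyz (by tauto)
      exact ⟨v, (hv.of_not_cross hD.left hc.not_cross).left⟩
    · obtain ⟨v, hv⟩ := h.exists_between_of_bichromatic hproper h1.left
        (by rintro rfl; exact hwp Iff.rfl) hyz (by tauto)
      exact ⟨v, hv.of_not_cross hD hc⟩
  rcases hD.side p with ⟨h1, h2⟩ | h1
  · obtain ⟨v, hv⟩ := key hD.symm hwx (by tauto) (by tauto) ⟨h1.symm, h2.symm⟩
    exact ⟨v, hv.symm⟩
  · exact key hD hyz (by tauto) (by tauto) h1

end Dense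

/-! ### Homogeneity implies equal sector numbers and the three alternatives. -/

theorem IsNodeSplitting.exists_setoid {𝒟 : DSet Ω} {C : Set (Set Ω)}
    (hC : 𝒟.IsNodeSplitting C) :
    ∃ s : Setoid Ω, 𝒟.IsSplit s ∧ s.classes = C ∧ ∃ a b c, ¬ s a b ∧ ¬ s a c ∧ ¬ s b c := by
  refine ⟨_, hC.1.isSplit, Setoid.classes_mkClasses C hC.1.1, ?_⟩
  obtain ⟨T, hT, hT3⟩ := Set.exists_subset_encard_eq (k := 3) (Order.add_one_le_of_lt hC.2)
  obtain ⟨A, B, E, hAB, hAE, hBE, rfl⟩ := Set.encard_eq_three.1 hT3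
  have hne : ∀ {S}, S ∈ C → S.Nonempty := fun hS =>
    Set.nonempty_iff_ne_empty.2 fun h => hC.1.1.1 (h ▸ hS)
  have hA : A ∈ C := hT (by simp)
  have hB : B ∈ C := hT (by simp)
  have hE : E ∈ C := hT (by simp)
  obtain ⟨a, ha⟩ := hne hA
  obtain ⟨b, hb⟩ := hne hB
  obtain ⟨e, he⟩ := hne hE
  have key : ∀ {S T x y}, S ∈ C → T ∈ C → x ∈ S → y ∈ T → S ≠ T →
      ¬ Setoid.mkClasses C hC.1.1.2 x y := fun {S T x y} hS hT hx hy hST h =>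
    hST ((hC.1.1.2 y).unique ⟨hS, h S hS hx⟩ ⟨hT, hy⟩)
  exact ⟨a, b, e, key hA hB ha hb hAB, key hA hE ha he hAE, key hB hE hb he hBE⟩

section Forward

variable {𝒟 : DSet Ω} {P : Set Ω}

/-- The splitting is the trace of a node of `Ω`. Among three elements of `P` in different sectors at
most one shares a sector with `r`, so two of them together with `r` determine the node. -/
theorem IsNodeSplitting.mk_eq_mk_quotient {C : Set (Set P)}
    (hC : (𝒟.restrict P).IsNodeSplitting C) (r : Ω) :
    ∃ (p q : Ω) (_ : p ∈ P) (_ : q ∈ P) (hpq : p ≠ q) (hpr : p ≠ r) (hqr : q ≠ r),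
      Cardinal.mk C =
        Cardinal.mk (Quotient ((𝒟.nodeSetoid hpq hpr hqr).comap (Subtype.val : P → Ω))) := by
  obtain ⟨s, hs, rfl, a, b, c, hab, hac, hbc⟩ := hC.exists_setoid
  have hne : ∀ {x y : P}, ¬ s x y → (x : Ω) ≠ y := fun h h' =>
    h (by rw [Subtype.ext h'])
  set t := 𝒟.nodeSetoid (hne hab) (hne hac) (hne hbc) with ht
  have htn : 𝒟.IsSplit t := isSplit_nodeSetoid _ _ _
  have hst : ∀ {u v : P}, s u v ↔ t u v := hs.rel_iff_nodeRel hab hac hbc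
  have key : ∀ x y : P, ¬ t x y → ¬ t x r → ¬ t y r →
      ∃ (p q : Ω) (_ : p ∈ P) (_ : q ∈ P) (hpq : p ≠ q) (hpr : p ≠ r) (hqr : q ≠ r),
      Cardinal.mk s.classes =
        Cardinal.mk (Quotient ((𝒟.nodeSetoid hpq hpr hqr).comap (Subtype.val : P → Ω))) := by
    intro x y hxy hxr hyr
    have hn : ∀ {x y : Ω}, ¬ t x y → x ≠ y := fun h h' => h (by rw [h'])
    refine ⟨x, y, x.2, y.2, hn hxy, hn hxr, hn hyr, ?_⟩
    have : s = (𝒟.nodeSetoid (hn hxy) (hn hxr) (hn hyr)).comap (Subtype.val : P → Ω) := by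
      ext u v
      exact hst.trans (htn.rel_iff_nodeRel hxy hxr hyr)
    rw [← this]
    exact (Cardinal.mk_congr s.quotientEquivClasses).symm
  have hab' : ¬ t a b := fun h => hab (hst.2 h)
  have hac' : ¬ t a c := fun h => hac (hst.2 h)
  have hbc' : ¬ t b c := fun h => hbc (hst.2 h)
  by_cases har : t a r
  · exact key b c hbc' (fun h => hab' (t.trans har (t.symm h)))
      fun h => hac' (t.trans har (t.symm h))
  by_cases hbr : t b r
  · exact key a c hac' har fun h => hbc' (t.trans hbr (t.symm h))
  · exact key a b hab' har hbr

theorem IsPHomogeneous.mk_eq_mk (h : 𝒟.IsPHomogeneous P) (C₁ C₂ : Set (Set P))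
    (h₁ : (𝒟.restrict P).IsNodeSplitting C₁) (h₂ : (𝒟.restrict P).IsNodeSplitting C₂) :
    Cardinal.mk C₁ = Cardinal.mk C₂ := by
  obtain ⟨r, hr⟩ := Set.nonempty_compl.2 h.2.1
  obtain ⟨p, q, hp, hq, hpq, hpr, hqr, e₁⟩ := h₁.mk_eq_mk_quotient r
  obtain ⟨p', q', hp', hq', hpq', hpr', hqr', e₂⟩ := h₂.mk_eq_mk_quotient r
  obtain ⟨σ, hσ, rfl, rfl, hσr⟩ := h.exists_aut_three hp hq hpq hr hp' hq' hpq' hr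
  rw [e₁, e₂]
  refine Cardinal.mk_congr (Quotient.congr (σ.subtypeEquiv fun x => (hσ.2 x).symm) ?_)
  intro u v
  have key : 𝒟.NodeRel p q r u v ↔ 𝒟.NodeRel (σ p) (σ q) (σ r) (σ u) (σ v) := by
    simp only [NodeRel, hσ.1]
  rwa [hσr] at key

/-- At the node of `p`, `p''`, `r` the element `p'` lies in the sector of `r`; an automorphism
fixing `p` and `r` moves this node to that of `p`, `p'`, `r`. -/
theorem IsPHomogeneous.exists_mem_sector (h : 𝒟.IsPHomogeneous P) {p p' p'' r : Ω} (hp : p ∈ P)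
    (hp' : p' ∈ P) (hp'' : p'' ∈ P) (hr : r ∉ P) (hpp' : p ≠ p') (hne : p'' ≠ p)
    (hD : 𝒟.D p'' p p' r) : ∃ u ∈ P, 𝒟.D u r p p' := by
  obtain ⟨σ, hσ, h1, h2, h3⟩ := h.exists_aut_three hp hp'' hne.symm hr hp hp' hpp' hr
  exact ⟨σ p', (hσ.2 p').2 hp', by
    have := (hσ.1 p' r p p'').2 hD.symm.right
    rwa [h1, h2, h3] at this⟩

theorem IsPHomogeneous.isTrueEdgeSplitting (h : 𝒟.IsPHomogeneous P) (hproper : 𝒟.IsProper)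
    {S : Set Ω} (hS : ∀ a ∈ S, ∀ b ∈ S, ∀ c ∉ S, ∀ d ∉ S, 𝒟.D a b c d) (hSP : S ⊆ P)
    (hSn : S.Nontrivial) (hP : P.encard ≠ 1) (hPc : Pᶜ.encard ≠ 1) :
    𝒟.IsTrueEdgeSplitting {P, Pᶜ} := by
  -- Moving `p`, `p'` into `S` shows that the sector of `p` at the node of `p`, `p'`, `r` has a
  -- single colour.
  have m1 : ∀ p ∈ P, ∀ p' ∈ P, p ≠ p' → ∀ r ∉ P, ∀ u, 𝒟.D u p p' r → u ∈ P := by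
    intro p hp p' hp' hpp' r hr u hu
    obtain ⟨s, hs, t, ht, hst⟩ := hSn
    obtain ⟨σ, hσ, h1, h2, h3⟩ := h.exists_aut_three hp hp' hpp' hr (hSP hs) (hSP ht) hst hr
    rw [← hσ.2]
    rw [← hσ.1, h1, h2, h3] at hu
    by_contra hn
    exact (hS s hs t ht (σ u) (fun h => hn (hSP h)) r fun h => hr (hSP h)).not_cross hu.left
  have m0 : ∀ p ∈ P, ∀ p' ∈ P, p ≠ p' → ∀ r ∉ P, ∃ u ∈ P, 𝒟.D u r p p' := by
    intro p hp p' hp' hpp' r hr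
    obtain ⟨p'', hne, hD⟩ := hproper.2 p' r p (by rintro rfl; exact hr hp') hpp'.symm
      (by rintro rfl; exact hr hp)
    have hD' := hD.symm.left
    exact h.exists_mem_sector hp hp' (m1 p hp p' hp' hpp' r hr p'' hD') hr hpp' hne hD'
  have m2 : ∀ p ∈ P, ∀ p' ∈ P, ∀ r ∉ P, ∀ r' ∉ P, 𝒟.D p p' r r' := by
    intro p hp p' hp' r hr r' hr'
    have hpr : p ≠ r := by rintro rfl; exact hr hp
    have hpr' : p ≠ r' := by rintro rfl; exact hr' hp
    have hp'r : p' ≠ r := by rintro rfl; exact hr hp'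
    by_cases hpp' : p = p'
    · subst hpp'
      exact D_diag_iff.2 ⟨hpr.symm, hpr'.symm⟩
    by_contra hD
    have hs := isSplit_nodeSetoid (𝒟 := 𝒟) hpp' hpr hp'r
    obtain ⟨n1, n2, n3⟩ := IsSplit.not_rel_nodeSetoid (𝒟 := 𝒟) hpp' hpr hp'r
    set s := 𝒟.nodeSetoid hpp' hpr hp'r
    have hrp : ¬ s r p := fun h => n2 (s.symm h)
    have hrp' : ¬ s r p' := fun h => n3 (s.symm h)
    have h1 : ¬ s p r' := fun h =>
      hr' (m1 p hp p' hp' hpp' r hr r' ((hs.rel_iff_D n1 n2 n3).1 (s.symm h)))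
    have h2 : ¬ s r r' := fun h => hD (hs.sep _ _ _ _ h hrp hrp').symm
    -- Replacing `p'` by some `u` in `P` from the sector of `r` gives a node at which `r'` lies in
    -- the sector of `p`, against `m1`.
    obtain ⟨u, huP, hu⟩ := m0 p hp p' hp' hpp' r hr
    have hur : s u r := hs.rel_of_D n1 hu
    have hup : ¬ s u p := fun h => n2 (s.symm (s.trans (s.symm hur) h))
    have hD' : 𝒟.D r' p u r :=
      (hs.sep u r r' p hur (fun h => h2 (s.trans (s.symm hur) h)) hup).symm
    exact hr' (m1 p hp u huP (fun h => hup (by rw [h])) r hr r' hD')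
  -- If all classes have one colour, each colour fills at most one class. A refining node splitting
  -- has three classes, two of them of the same colour.
  have m3 : ∀ {Q : Set Ω}, 𝒟.IsPHomogeneous Q → ∀ {s : Setoid Ω}, 𝒟.IsSplit s →
      (∀ x y, s x y → (x ∈ Q ↔ y ∈ Q)) → ∀ p ∈ Q, ∀ p' ∈ Q, ¬ s p p' → False := by
    intro Q hQ s hs hmono p hp p' hp' hn
    obtain ⟨r, hr⟩ := Set.nonempty_compl.2 hQ.2.1
    have hmono' : ∀ q ∈ Q, ¬ s q r := fun q hq h => hr ((hmono q r h).1 hq)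
    have hpp' : p ≠ p' := fun h => hn (by rw [h])
    obtain ⟨p'', hne, hD⟩ := hproper.2 p' r p (by rintro rfl; exact hr hp') hpp'.symm
      (by rintro rfl; exact hr hp)
    have hp'' : p'' ∈ Q :=
      (hmono p p'' (s.symm (hs.rel_of_D (hmono' p' hp') hD.symm.left))).1 hp
    obtain ⟨u, huQ, hu⟩ := hQ.exists_mem_sector hp hp' hp'' hr hpp' hne hD.symm.left
    exact hmono' u huQ (hs.rel_of_D hn hu)
  have hne : P ≠ Pᶜ := fun h0 => by
    obtain ⟨p, hp⟩ := Set.nonempty_iff_ne_empty.2 h.1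
    have hp2 := hp
    rw [h0] at hp2
    exact hp2 hp
  refine ⟨⟨⟨⟨?_, ?_⟩, (Set.encard_pair hne).ge, ?_, ?_⟩, Set.encard_pair hne⟩, ?_, ?_⟩
  · rintro (h0 | h0)
    · exact h.1 h0.symm
    · exact h.2.1 (Set.compl_empty_iff.1 h0.symm)
  · intro a
    by_cases ha : a ∈ P
    · refine ⟨P, ⟨by simp, ha⟩, ?_⟩
      rintro _ ⟨rfl | rfl, hy⟩
      · rfl
      · exact absurd ha hy
    · refine ⟨Pᶜ, ⟨by simp, ha⟩, ?_⟩
      rintro _ ⟨rfl | rfl, hy⟩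
      · exact absurd hy ha
      · rfl
  · rintro _ (rfl | rfl) a ha b hb c hc d hd
    · exact m2 a ha b hb c hc d hd
    · exact (m2 c (not_not.1 hc) d (not_not.1 hd) a ha b hb).symm
  · rintro _ (rfl | rfl) _ (rfl | rfl) _ (rfl | rfl) _ - <;> simp
  · rintro ⟨N, hN, hsub⟩
    obtain ⟨s, hs, rfl, a, b, c, hab, hac, hbc⟩ := hN.exists_setoid
    have hmono : ∀ x y, s x y → (x ∈ P ↔ y ∈ P) := by
      intro x y hxy
      obtain ⟨T, hT, hxT⟩ := hsub _ (s.mem_classes y)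
      have hx : x ∈ T := hxT hxy
      have hy : y ∈ T := hxT (s.refl y)
      rcases hT with rfl | rfl
      · exact iff_of_true hx hy
      · exact iff_of_false hx hy
    have m4 := m3 h hs hmono
    have m5 := m3 h.compl hs (fun x y hxy => not_iff_not.2 (hmono x y hxy))
    by_cases ha : a ∈ P <;> by_cases hb : b ∈ P <;> by_cases hc : c ∈ P
    · exact m4 a ha b hb hab
    · exact m4 a ha b hb hab
    · exact m4 a ha c hc hac
    · exact m5 b hb c hc hbc
    · exact m4 b hb c hc hbc
    · exact m5 a ha c hc hac
    · exact m5 a ha b hb hab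
    · exact m5 a ha b hb hab
  · rintro _ (rfl | rfl)
    · exact hP
    · exact hPc

theorem IsPHomogeneous.trichotomy (h : 𝒟.IsPHomogeneous P) (hproper : 𝒟.IsProper) :
    (∀ C : Set (Set Ω), 𝒟.IsSplitting C → ∀ S ∈ C, S.Infinite →
        (S ∩ P).Nonempty ∧ (S \ P).Nonempty) ∨
      𝒟.IsTrueEdgeSplitting {P, Pᶜ} ∨ (P.encard = 1 ∨ Pᶜ.encard = 1) := by
  by_contra! hn
  obtain ⟨⟨C, hC, S, hS, hSi, hSP⟩, hE, hP, hPc⟩ := hn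
  have hsep := hC.2.2.1 S hS
  by_cases h1 : S ⊆ P
  · exact hE (h.isTrueEdgeSplitting hproper hsep h1 hSi.nontrivial hP hPc)
  · have h2 : S ⊆ Pᶜ := by
      intro x hx hxP
      exact (Set.sdiff_nonempty.2 h1).ne_empty (hSP ⟨x, hx, hxP⟩)
    have h3 := h.compl.isTrueEdgeSplitting hproper hsep h2 hSi.nontrivial hPc
      (by rwa [compl_compl])
    rw [compl_compl, Set.pair_comm] at h3
    exact hE h3

end Forward

/-! ### Sectors: infinitude, extreme branches, and matching along partial isomorphisms. -/

/-- The equivalence relation has at least three classes. -/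
def HasThree (s : Setoid Ω) : Prop := ∃ a b c, ¬ s a b ∧ ¬ s a c ∧ ¬ s b c

section Sectors

variable {𝒟 : DSet Ω} {Q : Set Ω} {s : Setoid Ω} {a b c d u v w x y z : Ω}

/-- Properness puts a further element `z` in the sector of `u`, and the sector of `u` at the node of
`u`, `z`, `x` is strictly smaller, so a finite one would give infinite descent. -/
theorem IsProper.sector_infinite (hproper : 𝒟.IsProper) (huv : u ≠ v) (hux : u ≠ x)
    (hvx : v ≠ x) : {z | 𝒟.D z u v x}.Infinite := by
  intro hfin
  induction hn : {z | 𝒟.D z u v x}.ncard using Nat.strong_induction_on generalizing v with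
  | _ n ih =>
    obtain ⟨z, hzu, hz⟩ := hproper.2 v x u hvx huv.symm hux.symm
    have hz' : 𝒟.D z u v x := hz.symm.left
    have hss : {w | 𝒟.D w u z x} ⊂ {w | 𝒟.D w u v x} :=
      ⟨fun w hw => D.nested hw hz', fun h => (h hz' : 𝒟.D z u z x).ne₁₃ rfl⟩
    exact ih _ (hn ▸ Set.ncard_lt_ncard hss hfin) hzu.symm hz'.ne₁₄ (hfin.subset hss.1) rfl

theorem IsSplit.class_infinite (hs : 𝒟.IsSplit s) (hproper : 𝒟.IsProper) (h3 : HasThree s)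
    (u : Ω) : {x | s x u}.Infinite := by
  obtain ⟨v, x, hv, hx, hvx⟩ : ∃ v x, ¬ s u v ∧ ¬ s u x ∧ ¬ s v x := by
    obtain ⟨a, b, c, hab, hac, hbc⟩ := h3
    by_cases ha : s u a
    · exact ⟨b, c, fun h => hab (s.trans (s.symm ha) h), fun h => hac (s.trans (s.symm ha) h), hbc⟩
    by_cases hb : s u b
    · exact ⟨a, c, ha, fun h => hbc (s.trans (s.symm hb) h), hac⟩
    · exact ⟨a, b, ha, hb, hab⟩
  have hne : ∀ {x y}, ¬ s x y → x ≠ y := fun h h' => h (by rw [h'])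
  exact (hproper.sector_infinite (hne hv) (hne hx) (hne hvx)).mono fun z hz => hs.rel_of_D hvx hz

/-- An element of `F` whose branch leaves the path from `u` to `x` nearest to `u`, found by
minimising over nested sets. -/
theorem exists_forall_not_D {F : Set Ω} (hF : F.Finite) (hne : F.Nonempty) (u x : Ω) :
    ∃ b ∈ F, ∀ y ∈ F, ¬ 𝒟.D y u b x := by
  obtain ⟨b, hb, hmin⟩ := Finset.exists_min_image hF.toFinset
    (fun b => {y ∈ F | 𝒟.D y u b x}.ncard) (by simpa using hne)
  rw [hF.mem_toFinset] at hb
  refine ⟨b, hb, fun y hy hD => ?_⟩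
  have hss : {w ∈ F | 𝒟.D w u y x} ⊂ {w ∈ F | 𝒟.D w u b x} :=
    ⟨fun w hw => ⟨hw.1, D.nested hw.2 hD⟩,
      fun h => (h ⟨hy, hD⟩ : y ∈ F ∧ 𝒟.D y u y x).2.ne₁₃ rfl⟩
  exact (Set.ncard_lt_ncard hss (hF.subset fun _ h => h.1)).not_ge
    (hmin y (hF.mem_toFinset.2 hy))

/-- Among finitely many elements there is one whose branch leaves the path from `a` to `b`
closest to `b`. -/
theorem exists_extreme {F : Set Ω} (hF : F.Finite) (ha : a ∈ F) (b : Ω) :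
    ∃ a₁ ∈ F, ∀ d, 𝒟.D a a₁ b d → ∀ x ∈ F, 𝒟.D a x b d := by
  obtain ⟨a₁, ha₁, h⟩ := exists_forall_not_D (𝒟 := 𝒟) hF ⟨a, ha⟩ b a
  refine ⟨a₁, ha₁, fun d hd x hx => ?_⟩
  rcases hd.side x with ⟨h1, -⟩ | ⟨h1, -⟩
  · exact absurd h1.symm.left.right (h x hx)
  · exact h1

/-- As `x`, `y` are inequivalent and `Q` is separated from its complement, the whole complement lies
in one class; `hN` then puts an element of `Q` in it. -/
theorem IsSplit.forall_exists_mem (hs : 𝒟.IsSplit s)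
    (hE : ∀ p ∈ Q, ∀ p' ∈ Q, ∀ r ∉ Q, ∀ r' ∉ Q, 𝒟.D p p' r r')
    (hN : ∃ q ∈ Q, ∃ r ∉ Q, s q r) (hx : x ∈ Q) (hy : y ∈ Q) (hxy : ¬ s x y) (u : Ω) :
    ∃ q ∈ Q, s u q := by
  by_cases hu : u ∈ Q
  · exact ⟨u, hu, s.refl u⟩
  obtain ⟨q, hq, r, hr, hqr⟩ := hN
  exact ⟨q, hq, s.trans ((hs.rel_or_rel _ _ _ _ (hE x hx y hy u hu r hr)).resolve_left hxy)
    (s.symm hqr)⟩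

/-- When every sector meets `Q`, a node of `Ω` has as many sectors as the node splitting it induces
on `Q`. -/
theorem IsSplit.nonempty_quotient_equiv {s' : Setoid Ω} (hs : 𝒟.IsSplit s) (h3 : HasThree s)
    (hs' : 𝒟.IsSplit s') (h3' : HasThree s')
    (hcard : ∀ C₁ C₂ : Set (Set Q), (𝒟.restrict Q).IsNodeSplitting C₁ →
      (𝒟.restrict Q).IsNodeSplitting C₂ → Cardinal.mk C₁ = Cardinal.mk C₂)
    (hm : ∀ u, ∃ q ∈ Q, s u q) (hm' : ∀ u, ∃ q ∈ Q, s' u q) :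
    Nonempty (Quotient s ≃ Quotient s') := by
  have key : ∀ {s : Setoid Ω}, 𝒟.IsSplit s → HasThree s → (∀ u, ∃ q ∈ Q, s u q) →
      (𝒟.restrict Q).IsNodeSplitting (s.comap (Subtype.val : Q → Ω)).classes ∧
      Nonempty ((s.comap (Subtype.val : Q → Ω)).classes ≃ Quotient s) := by
    intro s hs h3 hm
    constructor
    · obtain ⟨a, b, c, hab, hac, hbc⟩ := h3
      obtain ⟨a', ha', haa⟩ := hm a
      obtain ⟨b', hb', hbb⟩ := hm b
      obtain ⟨c', hc', hcc⟩ := hm c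
      have hne : ∀ {x y x' y'}, s x x' → s y y' → ¬ s x y → ¬ s x' y' := fun h1 h2 h h' =>
        h (s.trans h1 (s.trans h' (s.symm h2)))
      exact (hs.restrict Q).isNodeSplitting_classes (a := ⟨a', ha'⟩) (b := ⟨b', hb'⟩)
        (c := ⟨c', hc'⟩) (hne haa hbb hab) (hne haa hcc hac) (hne hbb hcc hbc)
    · refine ⟨(Setoid.quotientEquivClasses _).symm.trans (Equiv.ofBijective
        (Quotient.map (sa := s.comap (Subtype.val : Q → Ω)) (sb := s) Subtype.val
          fun _ _ h => h) ⟨?_, ?_⟩)⟩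
      · rintro ⟨x⟩ ⟨y⟩ h
        have h' : s x.1 y.1 := Quotient.exact h
        exact Quotient.sound h'
      · rintro ⟨u⟩
        obtain ⟨q, hq, h⟩ := hm u
        exact ⟨Quotient.mk _ ⟨q, hq⟩, Quotient.sound (s.symm h)⟩
  obtain ⟨h1, ⟨e1⟩⟩ := key hs h3 hm
  obtain ⟨h2, ⟨e2⟩⟩ := key hs' h3' hm'
  obtain ⟨e⟩ := Cardinal.eq.1 (hcard _ _ h1 h2)
  exact ⟨e1.symm.trans (e.trans e2)⟩

/-- If the images of `f` met every class of `s'`, there would be finitely many classes on both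
sides, in equal number, so the domain of `f` would meet every class of `s`, including that of `c`.
-/
theorem exists_not_rel_of_equiv {s' : Setoid Ω} (e : Nonempty (Quotient s ≃ Quotient s'))
    {f : Set (Ω × Ω)} (hfin : f.Finite)
    (hf : ∀ p ∈ f, ∀ q ∈ f, (s p.1 q.1 ↔ s' p.2 q.2)) (hc : ∀ p ∈ f, ¬ s c p.1) :
    ∃ d, ∀ p ∈ f, ¬ s' d p.2 := by
  by_contra! hn
  have := hfin.to_subtype
  choose g hg hgs using hn
  have hfs : Function.Surjective fun p : f => (Quotient.mk s' p.1.2) := by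
    rintro ⟨d⟩
    exact ⟨⟨g d, hg d⟩, Quotient.sound (s'.symm (hgs d))⟩
  have := Finite.of_surjective _ hfs
  obtain ⟨e⟩ := e
  let G : Quotient s' → Quotient s := fun t => Quotient.mk s (Function.surjInv hfs t).1.1
  have hG : Function.Injective G := by
    intro t t' h
    have h1 : s _ _ := Quotient.exact h
    have h2 := Quotient.sound (s := s')
      ((hf _ (Function.surjInv hfs t).2 _ (Function.surjInv hfs t').2).1 h1)
    rw [← Function.surjInv_eq hfs t, ← Function.surjInv_eq hfs t']
    exact h2
  obtain ⟨t, ht⟩ := (hG.surjective_of_finite e.symm) (Quotient.mk s c)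
  have h1 : s _ _ := Quotient.exact ht
  exact hc _ (Function.surjInv hfs t).2 (s.symm h1)

/-- An element alone in its class has its `D`-relations dictated by the classes of the others. For
three others in one common class, it can be replaced by an element of the domain outside that class.
-/
theorem IsPartialAut.insert_of_isSplit {s' : Setoid Ω} {f : Set (Ω × Ω)}
    (hf : 𝒟.IsPartialAut Q f) (hs : 𝒟.IsSplit s) (hs' : 𝒟.IsSplit s') (hcd : c ∈ Q ↔ d ∈ Q)
    (hc : ∀ p ∈ f, ¬ s c p.1) (hd : ∀ p ∈ f, ¬ s' d p.2)
    (hss : ∀ p ∈ f, ∀ q ∈ f, (s p.1 q.1 ↔ s' p.2 q.2))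
    (hne : ∃ p ∈ f, ∃ q ∈ f, ¬ s p.1 q.1) : 𝒟.IsPartialAut Q (insert (c, d) f) := by
  refine hf.insert_pair hcd (fun p hp h => hc p hp (by rw [h])) (fun p hp h => hd p hp (by rw [h])) ?_
  intro p hp q hq r hr _ _ _
  by_cases hqr : s q.1 r.1
  · have hqr' := (hss q hq r hr).1 hqr
    by_cases hpq : s p.1 q.1
    · have hpq' := (hss p hp q hq).1 hpq
      obtain ⟨t, ht, hpt⟩ : ∃ t ∈ f, ¬ s p.1 t.1 := by
        obtain ⟨p₀, hp₀, q₀, hq₀, hn⟩ := hne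
        by_cases h : s p.1 p₀.1
        · exact ⟨q₀, hq₀, fun h' => hn (s.trans (s.symm h) h')⟩
        · exact ⟨p₀, hp₀, h⟩
      have hpt' : ¬ s' p.2 t.2 := fun h => hpt ((hss p hp t ht).2 h)
      have hcp : ¬ s p.1 c := fun h => hc p hp (s.symm h)
      have hdp : ¬ s' p.2 d := fun h => hd p hp (s'.symm h)
      exact (Iff.intro (hs.D_of_D hpq hcp hpt) (hs.D_of_D hpq hpt hcp)).trans
        ((hf.map t ht p hp q hq r hr).trans
          (Iff.intro (hs'.D_of_D hpq' hpt' hdp) (hs'.D_of_D hpq' hdp hpt')))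
    · have hpq' : ¬ s' p.2 q.2 := fun h => hpq ((hss p hp q hq).2 h)
      exact iff_of_true
        (hs.sep _ _ _ _ hqr (fun h => hc q hq (s.symm h)) fun h => hpq (s.symm h)).symm
        (hs'.sep _ _ _ _ hqr' (fun h => hd q hq (s'.symm h)) fun h => hpq' (s'.symm h)).symm
  · exact iff_of_false
      (fun h => (hs.rel_or_rel _ _ _ _ h).elim (hc p hp) hqr)
      fun h => (hs'.rel_or_rel _ _ _ _ h).elim (hd p hp) fun h => hqr ((hss q hq r hr).2 h)

end Sectors

/-! ### One-point extensions with prescribed colour. -/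

/-- The three situations in which elements of `Q` can be found in prescribed positions. -/
def Abundant (𝒟 : DSet Ω) (Q : Set Ω) : Prop :=
  (∀ s, 𝒟.IsSplit s → HasThree s → ∀ u, ∃ q ∈ Q, s u q) ∨
  ((∀ p ∈ Q, ∀ p' ∈ Q, ∀ r ∉ Q, ∀ r' ∉ Q, 𝒟.D p p' r r') ∧
    ∀ s, 𝒟.IsSplit s → HasThree s → ∃ q ∈ Q, ∃ r ∉ Q, s q r) ∨
  ∃ r, Qᶜ = {r}

section Extension

variable {𝒟 : DSet Ω} {Q : Set Ω} {s : Setoid Ω} {f : Set (Ω × Ω)} {c : Ω}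

theorem IsPartialAut.exists_node_point (hproper : 𝒟.IsProper) (hQ : 𝒟.Abundant Q)
    (hcard : ∀ C₁ C₂ : Set (Set Q), (𝒟.restrict Q).IsNodeSplitting C₁ →
      (𝒟.restrict Q).IsNodeSplitting C₂ → Cardinal.mk C₁ = Cardinal.mk C₂)
    (hf : 𝒟.IsPartialAut Q f) (hfin : f.Finite) (hfQ : ∃ p ∈ f, p.1 ∈ Q) (hcQ : c ∈ Q)
    (hs : 𝒟.IsSplit s) (hc : ∀ p ∈ f, ¬ s c p.1) {p q r : Ω × Ω} (hp : p ∈ f) (hq : q ∈ f)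
    (hr : r ∈ f) (hpq : ¬ s p.1 q.1) (hpr : ¬ s p.1 r.1) (hqr : ¬ s q.1 r.1) :
    ∃ d, 𝒟.IsPartialAut Q (insert (c, d) f) := by
  have hne : ∀ {p q}, p ∈ f → q ∈ f → ¬ s p.1 q.1 → p.2 ≠ q.2 := fun hp hq h h' =>
    h (by rw [(hf.eq _ hp _ hq).2 h'])
  have hs' := isSplit_nodeSetoid (𝒟 := 𝒟) (hne hp hq hpq) (hne hp hr hpr) (hne hq hr hqr)
  have hn := IsSplit.not_rel_nodeSetoid (𝒟 := 𝒟) (hne hp hq hpq) (hne hp hr hpr) (hne hq hr hqr)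
  have hss : ∀ x ∈ f, ∀ y ∈ f, (s x.1 y.1 ↔
      𝒟.nodeSetoid (hne hp hq hpq) (hne hp hr hpr) (hne hq hr hqr) x.2 y.2) := fun x hx y hy => by
    rw [hs.rel_iff_nodeRel hpq hpr hqr]
    exact or_congr (hf.map x hx y hy p hp q hq)
      (or_congr (hf.map x hx y hy q hq r hr) (hf.map x hx y hy p hp r hr))
  set s' := 𝒟.nodeSetoid (hne hp hq hpq) (hne hp hr hpr) (hne hq hr hqr)
  have h3 : HasThree s := ⟨_, _, _, hpq, hpr, hqr⟩
  have h3' : HasThree s' := ⟨_, _, _, hn⟩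
  obtain ⟨hm, hm'⟩ : (∀ u, ∃ q ∈ Q, s u q) ∧ (∀ u, ∃ q ∈ Q, s' u q) := by
    rcases hQ with hQ | ⟨hE, hN⟩ | ⟨r₀, hr₀⟩
    · exact ⟨hQ s hs h3, hQ s' hs' h3'⟩
    -- Since `c` is alone in its class, two inequivalent elements of the domain cannot both lie
    -- outside `Q`. Hence two of `p`, `q`, `r` lie in `Q`.
    · have two : ∀ {x y}, x ∈ f → y ∈ f → ¬ s x.1 y.1 → x.1 ∉ Q → y.1 ∈ Q := by
        intro x y hx hy hxy hxQ
        by_contra hyQ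
        obtain ⟨z, hz, hzQ⟩ := hfQ
        exact ((hs.rel_or_rel _ _ _ _ (hE c hcQ z.1 hzQ x.1 hxQ y.1 hyQ)).elim (hc z hz) hxy)
      have key : ∀ {x y}, x ∈ f → y ∈ f → ¬ s x.1 y.1 → x.1 ∈ Q → y.1 ∈ Q →
          (∀ u, ∃ q ∈ Q, s u q) ∧ (∀ u, ∃ q ∈ Q, s' u q) := fun {x y} hx hy hxy hxQ hyQ =>
        ⟨hs.forall_exists_mem hE (hN s hs h3) hxQ hyQ hxy,
          hs'.forall_exists_mem hE (hN s' hs' h3') ((hf.mem x hx).1 hxQ) ((hf.mem y hy).1 hyQ)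
            fun h => hxy ((hss x hx y hy).2 h)⟩
      by_cases hpQ : p.1 ∈ Q
      · by_cases hqQ : q.1 ∈ Q
        · exact key hp hq hpq hpQ hqQ
        · exact key hp hr hpr hpQ (two hq hr hqr hqQ)
      · exact key hq hr hqr (two hp hq hpq hpQ) (two hp hr hpr hpQ)
    · have key : ∀ {s : Setoid Ω}, 𝒟.IsSplit s → HasThree s → ∀ u, ∃ q ∈ Q, s u q := by
        intro s hs h3 u
        obtain ⟨x, hx, hxr⟩ := ((hs.class_infinite hproper h3 u).sdiff
          (Set.finite_singleton r₀)).nonempty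
        refine ⟨x, by_contra fun hxQ => hxr ?_, s.symm hx⟩
        rw [← hr₀]
        exact hxQ
      exact ⟨key hs h3, key hs' h3'⟩
  obtain ⟨d₀, hd₀⟩ := exists_not_rel_of_equiv
    (hs.nonempty_quotient_equiv h3 hs' h3' hcard hm hm') hfin hss hc
  obtain ⟨d, hdQ, hd⟩ := hm' d₀
  exact ⟨d, hf.insert_of_isSplit hs hs' (iff_of_true hcQ hdQ) hc
    (fun x hx h => hd₀ x hx (s'.trans hd h)) hss ⟨p, hp, q, hq, hpq⟩⟩

/-- Density is applied between the elements on either side whose images branch nearest to the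
opposite side; the point obtained then separates all images correctly. -/
theorem IsPartialAut.exists_edge_point (hdense : 𝒟.IsDense) (hf : 𝒟.IsPartialAut Q f)
    (hfin : f.Finite) (hs : 𝒟.IsSplit s) {p q : Ω × Ω} (hp : p ∈ f) (hq : q ∈ f)
    (hpq : ¬ s p.1 q.1) :
    ∃ v, ∀ x ∈ f, (s x.1 p.1 → 𝒟.D p.2 x.2 q.2 v) ∧ (s x.1 q.1 → 𝒟.D q.2 x.2 p.2 v) := by
  have hF : ∀ e : Ω, (Prod.snd '' {x ∈ f | s x.1 e}).Finite := fun e =>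
    (hfin.subset fun _ h => h.1).image _
  obtain ⟨_, ⟨p₁, ⟨hp₁, hsp⟩, rfl⟩, hpe⟩ :=
    exists_extreme (𝒟 := 𝒟) (hF p.1) ⟨p, ⟨hp, s.refl _⟩, rfl⟩ q.2
  obtain ⟨_, ⟨q₁, ⟨hq₁, hsq⟩, rfl⟩, hqe⟩ :=
    exists_extreme (𝒟 := 𝒟) (hF q.1) ⟨q, ⟨hq, s.refl _⟩, rfl⟩ p.2
  have hD : 𝒟.D p.1 p₁.1 q.1 q₁.1 :=
    hs.sep _ _ _ _ (s.symm hsp) hpq fun h => hpq (s.trans h hsq)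
  obtain ⟨v, -, h2, -, h4⟩ := hdense.2 _ _ _ _ ((hf.map p hp p₁ hp₁ q hq q₁ hq₁).1 hD)
  exact ⟨v, fun x hx => ⟨fun h => hpe v h4 _ ⟨x, ⟨hx, h⟩, rfl⟩,
    fun h => hqe v h2.symm _ ⟨x, ⟨hx, h⟩, rfl⟩⟩⟩

theorem IsPartialAut.exists_edge_point_of_mem
    (hE : ∀ p ∈ Q, ∀ p' ∈ Q, ∀ r ∉ Q, ∀ r' ∉ Q, 𝒟.D p p' r r')
    (hN : ∀ s, 𝒟.IsSplit s → HasThree s → ∃ q ∈ Q, ∃ r ∉ Q, s q r)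
    (hf : 𝒟.IsPartialAut Q f) (hfin : f.Finite) (hs : 𝒟.IsSplit s) (hcQ : c ∈ Q)
    (hc : ∀ x ∈ f, ¬ s c x.1) {p q : Ω × Ω} (hp : p ∈ f) (hq : q ∈ f) (hpq : ¬ s p.1 q.1)
    (hpQ : p.1 ∈ Q) (hqQ : q.1 ∉ Q) {v : Ω} (hvQ : v ∉ Q)
    (hv : ∀ x ∈ f, s x.1 q.1 → 𝒟.D q.2 x.2 p.2 v) :
    ∃ d ∈ Q, ∀ x ∈ f, (s x.1 p.1 → 𝒟.D p.2 x.2 q.2 d) ∧ (s x.1 q.1 → 𝒟.D q.2 x.2 p.2 d) := by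
  have hpQ' : p.2 ∈ Q := (hf.mem p hp).1 hpQ
  have hqQ' : q.2 ∉ Q := fun h => hqQ ((hf.mem q hq).2 h)
  have h1 : ∀ x ∈ f, s x.1 p.1 → x.2 ∈ Q := by
    intro x hx hxp
    rw [← hf.mem x hx]
    by_contra hxQ
    rcases hs.rel_or_rel _ _ _ _ (hE p.1 hpQ c hcQ q.1 hqQ x.1 hxQ) with h | h
    · exact hc p hp (s.symm h)
    · exact hpq (s.symm (s.trans h hxp))
  have h2 : ∀ x ∈ f, s x.1 q.1 → x.2 ∉ Q := by
    intro x hx hxq hxQ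
    exact (hE p.2 hpQ' x.2 hxQ q.2 hqQ' v hvQ).left.not_cross (hv x hx hxq).left
  obtain ⟨_, ⟨p₁, ⟨hp₁, hsp⟩, rfl⟩, hpe⟩ :=
    exists_extreme (𝒟 := 𝒟) (F := Prod.snd '' {x ∈ f | s x.1 p.1})
      ((hfin.subset fun _ h => h.1).image _) ⟨p, ⟨hp, s.refl _⟩, rfl⟩ q.2
  obtain ⟨d, hdQ, hd⟩ : ∃ d ∈ Q, 𝒟.D p.2 p₁.2 q.2 d := by
    have hpq' : p.2 ≠ q.2 := fun h => hqQ' (h ▸ hpQ')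
    by_cases hpp : p.2 = p₁.2
    · obtain ⟨d, hdQ, hd⟩ : ∃ d ∈ Q, d ≠ p.2 := by
        -- `c` and `p.1` are distinct elements of `Q`, so one of them differs from `p.2`.
        by_cases h : c = p.2
        · exact ⟨p.1, hpQ, fun h' => hc p hp (by rw [h, h'])⟩
        · exact ⟨c, hcQ, h⟩
      exact ⟨d, hdQ, hpp ▸ D_diag_iff.2 ⟨hpq'.symm, hd⟩⟩
    · have hp₁Q := h1 p₁ hp₁ hsp
      have hpq₁ : p₁.2 ≠ q.2 := fun h => hqQ' (h ▸ hp₁Q)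
      have hs' := isSplit_nodeSetoid (𝒟 := 𝒟) hpp hpq' hpq₁
      have hn := IsSplit.not_rel_nodeSetoid (𝒟 := 𝒟) hpp hpq' hpq₁
      obtain ⟨d, hdQ, hd⟩ := hs'.forall_exists_mem hE (hN _ hs' ⟨_, _, _, hn⟩) hpQ' hp₁Q hn.1 q.2
      exact ⟨d, hdQ, (hs'.sep _ _ _ _ hd (fun h => hn.2.1 (Setoid.symm' _ h))
        fun h => hn.2.2 (Setoid.symm' _ h)).symm⟩
  exact ⟨d, hdQ, fun x hx => ⟨fun h => hpe d hd _ ⟨x, ⟨hx, h⟩, rfl⟩,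
    fun h => (hE p.2 hpQ' d hdQ q.2 hqQ' x.2 (h2 x hx h)).symm⟩⟩

end Extension

section Extension

variable {𝒟 : DSet Ω} {P Q : Set Ω} {s : Setoid Ω} {f : Set (Ω × Ω)} {c : Ω}

theorem IsPartialAut.exists_colored_edge_point (hdense : 𝒟.IsDense) (hQ : 𝒟.Abundant Q)
    (hf : 𝒟.IsPartialAut Q f) (hfin : f.Finite) (hfQ : ∃ p ∈ f, p.1 ∈ Q)
    (hfQc : ∃ p ∈ f, p.1 ∉ Q) (hs : 𝒟.IsSplit s) (hcQ : c ∈ Q) (hc : ∀ x ∈ f, ¬ s c x.1)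
    {p q : Ω × Ω} (hp : p ∈ f) (hq : q ∈ f) (hpq : ¬ s p.1 q.1)
    (hall : ∀ x ∈ f, s x.1 p.1 ∨ s x.1 q.1) :
    ∃ d ∈ Q, ∀ x ∈ f, (s x.1 p.1 → 𝒟.D p.2 x.2 q.2 d) ∧ (s x.1 q.1 → 𝒟.D q.2 x.2 p.2 d) := by
  obtain ⟨v, hv⟩ := hf.exists_edge_point hdense hfin hs hp hq hpq
  by_cases hvQ : v ∈ Q
  · exact ⟨v, hvQ, hv⟩
  rcases hQ with hQ | ⟨hE, hN⟩ | ⟨r, hr⟩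
  · have h1 := (hv p hp).1 (s.refl _)
    have h2 := (hv q hq).2 (s.refl _)
    have hs' := isSplit_nodeSetoid (𝒟 := 𝒟) h1.ne₁₃ h1.ne₁₄ h2.ne₁₄
    have hn := IsSplit.not_rel_nodeSetoid (𝒟 := 𝒟) h1.ne₁₃ h1.ne₁₄ h2.ne₁₄
    -- Any element in the sector of `v` at the node of `p.2`, `q.2`, `v` serves as well as `v`, and
    -- every sector meets `Q`.
    obtain ⟨d, hdQ, hd⟩ := hQ _ hs' ⟨_, _, _, hn⟩ v
    set t := 𝒟.nodeSetoid h1.ne₁₃ h1.ne₁₄ h2.ne₁₄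
    obtain ⟨n1, n2, n3⟩ := hn
    refine ⟨d, hdQ, fun x hx => ⟨fun h => ?_, fun h => ?_⟩⟩
    · exact hs'.sep _ _ _ _ (t.symm ((hs'.rel_iff_D n1 n2 n3).2 ((hv x hx).1 h).left)) n1
        fun h => n2 (t.trans h (t.symm hd))
    · exact hs'.sep _ _ _ _ (t.symm (hs'.rel_of_D n2 ((hv x hx).2 h).left))
        (fun h => n1 (t.symm h)) fun h => n3 (t.trans h (t.symm hd))
  · have hv' : v ∉ Q := hvQ
    by_cases hpQ : p.1 ∈ Q
    · by_cases hqQ : q.1 ∈ Q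
      · obtain ⟨r, hr, hrQ⟩ := hfQc
        have hD := hE p.2 ((hf.mem p hp).1 hpQ) q.2 ((hf.mem q hq).1 hqQ) v hvQ r.2
          fun h => hrQ ((hf.mem r hr).2 h)
        rcases hall r hr with h | h
        · exact absurd ((hv r hr).1 h) hD.not_cross'
        · exact absurd ((hv r hr).2 h) hD.left.not_cross'
      · exact hf.exists_edge_point_of_mem hE hN hfin hs hcQ hc hp hq hpq hpQ hqQ hvQ
          fun x hx => (hv x hx).2
    · by_cases hqQ : q.1 ∈ Q
      · obtain ⟨d, hdQ, hd⟩ := hf.exists_edge_point_of_mem hE hN hfin hs hcQ hc hq hp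
          (fun h => hpq (s.symm h)) hqQ hpQ hvQ fun x hx => (hv x hx).1
        exact ⟨d, hdQ, fun x hx => (hd x hx).symm⟩
      · obtain ⟨z, hz, hzQ⟩ := hfQ
        exact ((hs.rel_or_rel _ _ _ _ (hE c hcQ z.1 hzQ p.1 hpQ q.1 hqQ)).elim (hc z hz)
          hpq).elim
  · obtain ⟨x, hx, hxQ⟩ := hfQc
    have h1 : v ∈ Qᶜ := hvQ
    have h2 : x.2 ∈ Qᶜ := fun h => hxQ ((hf.mem x hx).2 h)
    rw [hr] at h1 h2
    have h3 : x.2 = v := h2.trans h1.symm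
    rcases hall x hx with h | h
    · exact absurd h3 ((hv x hx).1 h).ne₂₄
    · exact absurd h3 ((hv x hx).2 h).ne₂₄

theorem IsPartialAut.exists_insert (hproper : 𝒟.IsProper) (hdense : 𝒟.IsDense)
    (hQ : 𝒟.Abundant Q)
    (hcard : ∀ C₁ C₂ : Set (Set Q), (𝒟.restrict Q).IsNodeSplitting C₁ →
      (𝒟.restrict Q).IsNodeSplitting C₂ → Cardinal.mk C₁ = Cardinal.mk C₂)
    (hf : 𝒟.IsPartialAut Q f) (hfin : f.Finite) (hfQ : ∃ p ∈ f, p.1 ∈ Q)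
    (hfQc : ∃ p ∈ f, p.1 ∉ Q) (hcQ : c ∈ Q) (hcf : ∀ p ∈ f, c ≠ p.1) :
    ∃ d, 𝒟.IsPartialAut Q (insert (c, d) f) := by
  obtain ⟨p, hp, hpQ⟩ := hfQ
  obtain ⟨r, hr, hrQ⟩ := hfQc
  -- Choosing `q` to branch from the path between `c` and `p.1` nearest to `c` leaves `c` alone in
  -- its sector at the node of `p.1`, `q.1`, `c`.
  obtain ⟨_, ⟨⟨q, hq, rfl⟩, hqp⟩, hmin⟩ := exists_forall_not_D (𝒟 := 𝒟)
    (F := Prod.fst '' f \ {p.1}) ((hfin.image _).sdiff)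
    ⟨r.1, ⟨r, hr, rfl⟩, fun h => hrQ (by rw [Set.mem_singleton_iff.1 h]; exact hpQ)⟩ c p.1
  have hpq : p.1 ≠ q.1 := fun h => hqp h.symm
  have hs := isSplit_nodeSetoid (𝒟 := 𝒟) hpq (hcf p hp).symm (hcf q hq).symm
  obtain ⟨n1, n2, n3⟩ :=
    IsSplit.not_rel_nodeSetoid (𝒟 := 𝒟) hpq (hcf p hp).symm (hcf q hq).symm
  set s := 𝒟.nodeSetoid hpq (hcf p hp).symm (hcf q hq).symm
  have hc : ∀ x ∈ f, ¬ s c x.1 := by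
    intro x hx h
    have hD := (hs.rel_iff_D (fun h => n2 (s.symm h)) (fun h => n3 (s.symm h)) n1).1 (s.symm h)
    exact hmin x.1 ⟨⟨x, hx, rfl⟩, hD.ne₁₃⟩ hD.right
  -- If only two other sectors are occupied, `c` joins inside an edge of the spanned tree; otherwise
  -- it joins at one of its nodes.
  by_cases hall : ∀ x ∈ f, s x.1 p.1 ∨ s x.1 q.1
  · obtain ⟨d, hdQ, hd⟩ := hf.exists_colored_edge_point hdense hQ hfin ⟨p, hp, hpQ⟩
      ⟨r, hr, hrQ⟩ hs hcQ hc hp hq n1 hall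
    have h1 := (hd p hp).1 (s.refl _)
    have h2 := (hd q hq).2 (s.refl _)
    have hs' := isSplit_nodeSetoid (𝒟 := 𝒟) h1.ne₁₃ h1.ne₁₄ h2.ne₁₄
    have hn := IsSplit.not_rel_nodeSetoid (𝒟 := 𝒟) h1.ne₁₃ h1.ne₁₄ h2.ne₁₄
    set t := 𝒟.nodeSetoid h1.ne₁₃ h1.ne₁₄ h2.ne₁₄
    obtain ⟨m1, m2, m3⟩ := hn
    have k1 : ∀ x ∈ f, s x.1 p.1 → t x.2 p.2 := fun x hx h =>
      (hs'.rel_iff_D m1 m2 m3).2 ((hd x hx).1 h).left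
    have k2 : ∀ x ∈ f, s x.1 q.1 → t x.2 q.2 := fun x hx h =>
      hs'.rel_of_D m2 ((hd x hx).2 h).left
    refine ⟨d, hf.insert_of_isSplit hs hs' (iff_of_true hcQ hdQ) hc ?_ ?_ ⟨p, hp, q, hq, n1⟩⟩
    · intro x hx h
      rcases hall x hx with hx' | hx'
      · exact m2 (t.symm (t.trans h (k1 x hx hx')))
      · exact m3 (t.symm (t.trans h (k2 x hx hx')))
    · intro x hx y hy
      rcases hall x hx with hx' | hx' <;> rcases hall y hy with hy' | hy'
      · exact iff_of_true (s.trans hx' (s.symm hy')) (t.trans (k1 x hx hx') (t.symm (k1 y hy hy')))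
      · exact iff_of_false (fun h => n1 (s.trans (s.symm hx') (s.trans h hy')))
          fun h => m1 (t.trans (t.symm (k1 x hx hx')) (t.trans h (k2 y hy hy')))
      · exact iff_of_false (fun h => n1 (s.trans (s.symm hy') (s.trans (s.symm h) hx')))
          fun h => m1 (t.trans (t.symm (k1 y hy hy')) (t.trans (t.symm h) (k2 x hx hx')))
      · exact iff_of_true (s.trans hx' (s.symm hy')) (t.trans (k2 x hx hx') (t.symm (k2 y hy hy')))
  · push Not at hall
    obtain ⟨x, hx, hxp, hxq⟩ := hall
    exact hf.exists_node_point hproper hQ hcard hfin ⟨p, hp, hpQ⟩ hcQ hs hc hp hq hx n1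
      (fun h => hxp (s.symm h)) fun h => hxq (s.symm h)

/-! ### Back and forth. -/

theorem IsPartialAut.compl (hf : 𝒟.IsPartialAut P f) : 𝒟.IsPartialAut Pᶜ f :=
  ⟨fun p hp => not_iff_not.2 (hf.mem p hp), hf.eq, hf.map⟩

/-- Back and forth: if finite partial automorphisms meeting both `P` and its complement can be
extended by one point, then they extend to automorphisms. -/
theorem IsPartialAut.exists_aut_of_extension [Countable Ω]
    (hext : ∀ f : Set (Ω × Ω), 𝒟.IsPartialAut P f → f.Finite → (∃ p ∈ f, p.1 ∈ P) →
      (∃ p ∈ f, p.1 ∉ P) → ∀ c, ∃ d, 𝒟.IsPartialAut P (insert (c, d) f))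
    (hf : 𝒟.IsPartialAut P f) (hfin : f.Finite) (hfP : ∃ p ∈ f, p.1 ∈ P)
    (hfPc : ∃ p ∈ f, p.1 ∉ P) :
    ∃ σ : Equiv.Perm Ω, 𝒟.IsAut P σ ∧ ∀ p ∈ f, σ p.1 = p.2 := by
  have := Encodable.ofCountable Ω
  let T := {g : Set (Ω × Ω) // 𝒟.IsPartialAut P g ∧ g.Finite ∧ f ⊆ g}
  -- One cofinal family for each element to enter the domain and one for each element to enter the
  -- range; an ideal meeting all of them has a total bijection as its union.
  let E : Ω ⊕ Ω → Order.Cofinal T := fun e =>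
    { carrier := {g | e.elim (fun c => ∃ d, (c, d) ∈ g.1) (fun d => ∃ c, (c, d) ∈ g.1)}
      isCofinal := by
        rintro ⟨g, hg, hgfin, hfg⟩
        obtain ⟨p, hp, hpP⟩ := hfP
        obtain ⟨q, hq, hqP⟩ := hfPc
        rcases e with c | d
        · obtain ⟨d, hd⟩ := hext g hg hgfin ⟨p, hfg hp, hpP⟩ ⟨q, hfg hq, hqP⟩ c
          exact ⟨⟨_, hd, hgfin.insert _, hfg.trans (Set.subset_insert _ _)⟩,
            ⟨d, Set.mem_insert _ _⟩, Set.subset_insert _ _⟩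
        · obtain ⟨c, hc⟩ := hext _ hg.swap (hgfin.image _)
            ⟨p.swap, ⟨p, hfg hp, rfl⟩, (hg.mem p (hfg hp)).1 hpP⟩
            ⟨q.swap, ⟨q, hfg hq, rfl⟩, fun h => hqP ((hg.mem q (hfg hq)).2 h)⟩ d
          have hc' := hc.swap
          rw [Set.image_insert_eq, Set.image_image] at hc'
          simp only [Prod.swap_swap, Set.image_id', Prod.swap_prod_mk] at hc'
          exact ⟨⟨_, hc', hgfin.insert _, hfg.trans (Set.subset_insert _ _)⟩,
            ⟨c, Set.mem_insert _ _⟩, Set.subset_insert _ _⟩ }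
  let f₀ : T := ⟨f, hf, hfin, subset_rfl⟩
  let I := Order.idealOfCofinals f₀ E
  let G : Set (Ω × Ω) := ⋃ g ∈ I, g.1
  have hmem : ∀ {x}, x ∈ G → ∃ g ∈ I, x ∈ g.1 := fun hx => by simpa [G] using hx
  have hG : 𝒟.IsPartialAut P G := by
    have two : ∀ g ∈ I, ∀ g' ∈ I, ∃ k ∈ I, g.1 ⊆ k.1 ∧ g'.1 ⊆ k.1 := fun g hg g' hg' =>
      I.directed g hg g' hg'
    refine ⟨fun p hp => ?_, fun p hp q hq => ?_, fun p hp q hq r hr t ht => ?_⟩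
    · obtain ⟨g, -, hpg⟩ := hmem hp
      exact g.2.1.mem p hpg
    · obtain ⟨g, hg, hpg⟩ := hmem hp
      obtain ⟨g', hg', hqg⟩ := hmem hq
      obtain ⟨k, -, h1, h2⟩ := two g hg g' hg'
      exact k.2.1.eq p (h1 hpg) q (h2 hqg)
    · obtain ⟨g₁, hg₁, hp⟩ := hmem hp
      obtain ⟨g₂, hg₂, hq⟩ := hmem hq
      obtain ⟨g₃, hg₃, hr⟩ := hmem hr
      obtain ⟨g₄, hg₄, ht⟩ := hmem ht
      obtain ⟨k, hk, h1, h2⟩ := two g₁ hg₁ g₂ hg₂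
      obtain ⟨k', hk', h3, h4⟩ := two g₃ hg₃ g₄ hg₄
      obtain ⟨l, -, h5, h6⟩ := two k hk k' hk'
      exact l.2.1.map p (h5 (h1 hp)) q (h5 (h2 hq)) r (h6 (h3 hr)) t (h6 (h4 ht))
  have hfG : f ⊆ G := Set.subset_biUnion_of_mem (u := fun g : T => g.1)
    (Order.mem_idealOfCofinals f₀ E)
  have hl : ∀ c, ∃ d, (c, d) ∈ G := fun c => by
    obtain ⟨g, ⟨d, hd⟩, hg⟩ := Order.cofinal_meets_idealOfCofinals f₀ E (Sum.inl c)
    exact ⟨d, Set.mem_biUnion hg hd⟩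
  have hr : ∀ d, ∃ c, (c, d) ∈ G := fun d => by
    obtain ⟨g, ⟨c, hc⟩, hg⟩ := Order.cofinal_meets_idealOfCofinals f₀ E (Sum.inr d)
    exact ⟨c, Set.mem_biUnion hg hc⟩
  choose φ hφ using hl
  choose ψ hψ using hr
  refine ⟨⟨φ, ψ, fun c => (hG.eq _ (hψ _) _ (hφ c)).2 rfl, fun d => (hG.eq _ (hφ _) _ (hψ d)).1 rfl⟩,
    ⟨fun w x y z => (hG.map _ (hφ w) _ (hφ x) _ (hφ y) _ (hφ z)).symm,
      fun x => (hG.mem _ (hφ x)).symm⟩, fun p hp => (hG.eq _ (hφ p.1) p (hfG hp)).1 rfl⟩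

theorem IsProper.infinite (hproper : 𝒟.IsProper) (h : ∃ s, 𝒟.IsSplit s ∧ HasThree s) :
    Infinite Ω := by
  obtain ⟨s, hs, h3⟩ := h
  obtain ⟨a, -⟩ := id h3
  exact Set.infinite_univ_iff.1 ((hs.class_infinite hproper h3 a).mono (Set.subset_univ _))

theorem IsProper.exists_isSplit (hproper : 𝒟.IsProper) : ∃ s, 𝒟.IsSplit s ∧ HasThree s := by
  have h := hproper.1
  rw [← Set.encard_univ] at h
  obtain ⟨T, -, hT⟩ := Set.exists_subset_encard_eq h
  obtain ⟨a, b, c, hab, hac, hbc, -⟩ := Set.encard_eq_three.1 hT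
  exact ⟨_, isSplit_nodeSetoid hab hac hbc, _, _, _, IsSplit.not_rel_nodeSetoid hab hac hbc⟩

/-- A node splitting with all classes of one colour would refine the edge splitting. -/
theorem IsTrueEdgeSplitting.abundant (h : 𝒟.IsTrueEdgeSplitting {P, Pᶜ}) : 𝒟.Abundant P := by
  refine Or.inr (Or.inl ⟨fun p hp p' hp' r hr r' hr' =>
    h.1.1.2.2.1 P (by simp) p hp p' hp' r hr r' hr', fun s hs ⟨a, b, c, hab, hac, hbc⟩ => ?_⟩)
  by_contra! hn
  refine h.2.1 ⟨s.classes, hs.isNodeSplitting_classes hab hac hbc, ?_⟩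
  rintro _ ⟨e, rfl⟩
  by_cases he : e ∈ P
  · exact ⟨P, by simp, fun x hx => by_contra fun hxP => hn e he x hxP (s.symm hx)⟩
  · exact ⟨Pᶜ, by simp, fun x hx hxP => hn x hxP e he hx⟩

theorem isPHomogeneous_of_abundant [Countable Ω] (hproper : 𝒟.IsProper) (hdense : 𝒟.IsDense)
    (hP0 : P ≠ ∅) (hP1 : P ≠ Set.univ)
    (hcard : ∀ C₁ C₂ : Set (Set P), (𝒟.restrict P).IsNodeSplitting C₁ →
      (𝒟.restrict P).IsNodeSplitting C₂ → Cardinal.mk C₁ = Cardinal.mk C₂)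
    (hcard' : ∀ C₁ C₂ : Set (Set (Pᶜ : Set Ω)), (𝒟.restrict Pᶜ).IsNodeSplitting C₁ →
      (𝒟.restrict Pᶜ).IsNodeSplitting C₂ → Cardinal.mk C₁ = Cardinal.mk C₂)
    (hP : 𝒟.Abundant P ∨ ∃ r, P = {r}) (hPc : 𝒟.Abundant Pᶜ ∨ ∃ r, Pᶜ = {r}) :
    𝒟.IsPHomogeneous P := by
  have hext : ∀ f : Set (Ω × Ω), 𝒟.IsPartialAut P f → f.Finite → (∃ p ∈ f, p.1 ∈ P) →
      (∃ p ∈ f, p.1 ∉ P) → ∀ c, ∃ d, 𝒟.IsPartialAut P (insert (c, d) f) := by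
    intro f hf hfin hfP hfPc c
    by_cases hcf : ∀ p ∈ f, c ≠ p.1
    · by_cases hcP : c ∈ P
      · rcases hP with hP | ⟨r, rfl⟩
        · exact hf.exists_insert hproper hdense hP hcard hfin hfP hfPc hcP hcf
        -- The only element of a singleton colour is already in the domain.
        · obtain ⟨p, hp, hpP⟩ := hfP
          exact absurd (hcP.trans hpP.symm) (hcf p hp)
      · have hcP' : c ∈ Pᶜ := hcP
        obtain ⟨p, hp, hpP⟩ := hfPc
        rcases hPc with hPc | ⟨r, hr⟩
        · obtain ⟨q, hq, hqP⟩ := hfP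
          obtain ⟨d, hd⟩ := hf.compl.exists_insert hproper hdense hPc hcard' hfin ⟨p, hp, hpP⟩
            ⟨q, hq, fun h => h hqP⟩ hcP' hcf
          have := hd.compl
          rw [compl_compl] at this
          exact ⟨d, this⟩
        · have hpP' : p.1 ∈ Pᶜ := hpP
          rw [hr] at hcP' hpP'
          exact absurd (hcP'.trans hpP'.symm) (hcf p hp)
    · push Not at hcf
      obtain ⟨p, hp, rfl⟩ := hcf
      exact ⟨p.2, by rwa [Set.insert_eq_of_mem hp]⟩
  refine ⟨hP0, hP1, ?_⟩
  intro A B hA _ ⟨a, ha, haP⟩ ⟨b, hb, hbP⟩ _ _ φ hφ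
  have := hA.to_subtype
  have hf : 𝒟.IsPartialAut P (Set.range fun a : A => ((a : Ω), (φ a : Ω))) := by
    refine ⟨?_, ?_, ?_⟩
    · rintro _ ⟨x, rfl⟩
      exact (hφ.2 x).symm
    · rintro _ ⟨x, rfl⟩ _ ⟨y, rfl⟩
      simp [Subtype.coe_inj]
    · rintro _ ⟨w, rfl⟩ _ ⟨x, rfl⟩ _ ⟨y, rfl⟩ _ ⟨z, rfl⟩
      exact (hφ.1 w x y z).symm
  obtain ⟨σ, hσ, h⟩ := hf.exists_aut_of_extension hext (Set.finite_range _)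
    ⟨_, ⟨⟨a, ha⟩, rfl⟩, haP⟩ ⟨_, ⟨⟨b, hb⟩, rfl⟩, hbP⟩
  exact ⟨σ, hσ, fun x => h _ ⟨x, rfl⟩⟩

end Extension
end DSet

/-! ### Assembly of the two directions. -/

theorem mainTheorem5 {Ω : Type u} [Countable Ω] (𝒟 : DSet Ω) (hproper : 𝒟.IsProper)
    (P : Set Ω) :
    𝒟.IsPHomogeneous P ↔
      𝒟.IsDense ∧
      ((∀ C₁ C₂ : Set (Set P), (𝒟.restrict P).IsNodeSplitting C₁ →
          (𝒟.restrict P).IsNodeSplitting C₂ → Cardinal.mk C₁ = Cardinal.mk C₂) ∧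
        (∀ C₁ C₂ : Set (Set (Pᶜ : Set Ω)), (𝒟.restrict Pᶜ).IsNodeSplitting C₁ →
          (𝒟.restrict Pᶜ).IsNodeSplitting C₂ → Cardinal.mk C₁ = Cardinal.mk C₂)) ∧
      ((∀ C : Set (Set Ω), 𝒟.IsSplitting C → ∀ S ∈ C, S.Infinite →
          (S ∩ P).Nonempty ∧ (S \ P).Nonempty) ∨
        𝒟.IsTrueEdgeSplitting {P, Pᶜ} ∨
        (P.encard = 1 ∨ Pᶜ.encard = 1)) := by
  constructor
  · intro h
    exact ⟨h.isDense hproper, ⟨h.mk_eq_mk, h.compl.mk_eq_mk⟩, h.trichotomy hproper⟩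
  rintro ⟨hdense, ⟨hcard, hcard'⟩, hcase⟩
  have hsp := hproper.exists_isSplit
  -- Infinitude ensures that a singleton colour leaves the other colour nonempty.
  have hinf := hproper.infinite hsp
  obtain ⟨h0, h1, hP, hPc⟩ : P ≠ ∅ ∧ P ≠ Set.univ ∧ (𝒟.Abundant P ∨ ∃ r, P = {r}) ∧
      (𝒟.Abundant Pᶜ ∨ ∃ r, Pᶜ = {r}) := by
    rcases hcase with hcase | hcase | hcase | hcase
    · have key : ∀ s, 𝒟.IsSplit s → DSet.HasThree s → ∀ u,
          ({x | s x u} ∩ P).Nonempty ∧ ({x | s x u} \ P).Nonempty := by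
        intro s hs h3 u
        obtain ⟨a, b, c, hab, -⟩ := id h3
        exact hcase _ (hs.isSplitting_classes hab) _ (s.mem_classes u)
          (hs.class_infinite hproper h3 u)
      obtain ⟨s, hs, h3⟩ := hsp
      obtain ⟨a, -⟩ := id h3
      obtain ⟨⟨x, -, hx⟩, ⟨y, -, hy⟩⟩ := key s hs h3 a
      refine ⟨?_, ?_, Or.inl (Or.inl fun s hs h3 u => ?_), Or.inl (Or.inl fun s hs h3 u => ?_)⟩
      · rintro rfl
        exact hx
      · rintro rfl
        exact hy trivial
      · obtain ⟨q, hq, hqP⟩ := (key s hs h3 u).1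
        exact ⟨q, hqP, s.symm hq⟩
      · obtain ⟨q, hq, hqP⟩ := (key s hs h3 u).2
        exact ⟨q, hqP, s.symm hq⟩
    · have hempty := hcase.1.1.1.1
      refine ⟨?_, ?_, Or.inl hcase.abundant, Or.inl ?_⟩
      · rintro rfl
        exact hempty (by simp)
      · rintro rfl
        exact hempty (by simp)
      · refine DSet.IsTrueEdgeSplitting.abundant ?_
        rwa [compl_compl, Set.pair_comm]
    · obtain ⟨r, rfl⟩ := Set.encard_eq_one.1 hcase
      exact ⟨Set.singleton_ne_empty r, fun h => Set.infinite_univ (h ▸ Set.finite_singleton r),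
        Or.inr ⟨r, rfl⟩, Or.inl (Or.inr (Or.inr ⟨r, compl_compl _⟩))⟩
    · obtain ⟨r, hr⟩ := Set.encard_eq_one.1 hcase
      refine ⟨?_, ?_, Or.inl (Or.inr (Or.inr ⟨r, hr⟩)), Or.inr ⟨r, hr⟩⟩
      · rintro rfl
        rw [Set.compl_empty] at hr
        exact Set.infinite_univ (hr ▸ Set.finite_singleton r)
      · rintro rfl
        rw [Set.compl_univ] at hr
        exact Set.singleton_ne_empty r hr.symm
  exact DSet.isPHomogeneous_of_abundant hproper hdense h0 h1 hcard hcard' hP hPc
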